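/- **Setting.** Let $x_1,\dots,x_m\in\mathbb R^n$, let $\ell_1,\dots,\ell_m:\mathbb R^p\to\mathbb R$ be convex and $\rho$-Lipschitz (Euclidean norm), $\rho>0$, and let $L(W)=\frac1m\sum_{i=1}^m\ell_i(Wx_i)$ for $W\in\mathbb R^{p\times n}$. Let $W^\star$ be a minimizer of $L$ and let $\sigma\ge\|W^\star\|_{\mathrm{sp}}$ (spectral norm). Put $X=[x_1,\dots,x_m]\in\mathbb R^{n\times m}$ and $C=\frac1m XX^\top=UDU^\top$ with $U$ orthogonal and $D=\mathrm{diag}(\lambda_1\ge\dots\ge\lambda_n)$. Let $1\le k<n$, assume $\mathrm{rank}(C)\ge k$, and let $C_k=U_kD_kU_k^\top$ be the best rank-$k$ approximation of $C$. **Sketched conditioner.** Draw $\Omega\in\mathbb R^{m\times r}$ with i.i.d. $N(0,1/r)$ entries. Let $P$ be the orthonormal factor of a QR factorization of $X\Omega$ (an orthonormal basis of the column space of $X\Omega$). Let $U'_k$ consist of the top $k$ left singular vectors of $P^\top X$, and put $Q=PU'_k\in\mathbb R^{n\times k}$. Let $\tilde C=Q^\top CQ$, $B=\tilde C^{1/2}$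 and $a^{-1}=\sqrt{\frac{n-k}{\mathrm{tr}\,C-\mathrm{tr}\,\tilde C}}$. The conditioner $A=QBQ^\top+a(I-QQ^\top)$ is applied through $A^{-1}=QB^{-1}Q^\top+a^{-1}(I-QQ^\top)$. (If $\mathrm{tr}\,C=\mathrm{tr}\,\tilde C$, then $(I-QQ^\top)x_i=0$ for all $i$ and the value of $a^{-1}$ does not matter; take $a^{-1}=0$.) **SCSGD.** Start at $W_1=0$. At step $t$ draw $i_t\in\{1,\dots,m\}$ uniformly, independently of the past and of $\Omega$, and set $W_{t+1}=W_t-\eta\,\nabla\ell_{i_t}(W_tx_{i_t})\,(A^{-1}x_{i_t})^\top$, where $\nabla\ell_i$ is a (measurable) choice of subgradients of $\ell_i$ and $\eta=\sigma/(\rho\sqrt T)$. Let $T\ge1$ and $\bar W=\frac1T\sum_{t=1}^TW_t$. **Theorem.** For every $c>1$ there is a constant $K>0$ depending only on $c$ such that, for all data as above with $r\ge ck$ (where $Q$ is a measurable function of $\Omega$), the expectation below, over $\Omega$ and the drawn indices, is well defined and finite, and $$\mathbb E\bigl[L(\bar W)-L(W^\star)\bigr]\le K\,\beta,\qquad \beta:=\frac{\sigma\rho}{\sqrt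 T}\Bigl(\mathrm{tr}(C_k^{1/2})+\sqrt{(n-k)(\mathrm{tr}\,C-\mathrm{tr}\,C_k)}\Bigr).$$ In particular, let $\beta^\star:=\frac{\sigma\rho}{\sqrt T}\,\mathrm{tr}(C^{1/2})$, the bound for the conditioner $C^{1/2}$. If the fast spectral decay property $\sqrt{(n-k)(\mathrm{tr}\,C-\mathrm{tr}\,C_k)}\le\kappa\,\mathrm{tr}(C^{1/2})$ holds with some $\kappa\ge0$, then $\beta$ is of the same order as $\beta^\star$, namely $\beta^\star\le\beta\le(1+\kappa)\beta^\star$, and hence $\mathbb E[L(\bar W)-L(W^\star)]\le K(1+\kappa)\beta^\star$. -/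

import Mathlib

open MeasureTheory ProbabilityTheory
open scoped NNReal Matrix

noncomputable section

namespace SCSGD

/-- The square root `M^{1/2}` of a positive semidefinite matrix (continuous functional calculus). -/
def psdSqrt {k : ℕ} (M : Matrix (Fin k) (Fin k) ℝ) : Matrix (Fin k) (Fin k) ℝ :=
  cfc Real.sqrt M

/-- The spectral norm of a matrix: its operator norm between Euclidean spaces. -/
def specNorm {p n : ℕ} (W : Matrix (Fin p) (Fin n) ℝ) : ℝ :=
  ‖(Matrix.toEuclideanLin W).toContinuousLinearMap‖

/-- The data matrix `X`, whose columns are the instances `x_1, …, x_m`. -/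
def dataMatrix {n m : ℕ} (x : Fin m → Fin n → ℝ) : Matrix (Fin n) (Fin m) ℝ :=
  (Matrix.of x)ᵀ

/-- The correlation matrix `C = (1/m) ∑ x_i x_iᵀ`. -/
def corr {n m : ℕ} (x : Fin m → Fin n → ℝ) : Matrix (Fin n) (Fin n) ℝ :=
  (m : ℝ)⁻¹ • ∑ i, Matrix.vecMulVec (x i) (x i)

/-- `M = U diag(d) Uᵀ` with `U` orthogonal and `d` in decreasing order. -/
structure IsSortedEigendecomposition {s : ℕ} (M U : Matrix (Fin s) (Fin s) ℝ)
    (d : Fin s → ℝ) : Prop where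
  orthogonal : Uᵀ * U = 1
  sorted : Antitone d
  eq : M = U * Matrix.diagonal d * Uᵀ

/-- The matrix `U_k` of the first `k` columns of `U`. -/
def firstCols {a s k : ℕ} (hk : k ≤ s) (U : Matrix (Fin a) (Fin s) ℝ) :
    Matrix (Fin a) (Fin k) ℝ :=
  U.submatrix id (Fin.castLE hk)

/-- The best rank-`k` approximation `U_k D_k U_kᵀ` of `U D Uᵀ`. -/
def truncation {n k : ℕ} (hk : k ≤ n) (U : Matrix (Fin n) (Fin n) ℝ) (d : Fin n → ℝ) :
    Matrix (Fin n) (Fin n) ℝ :=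
  firstCols hk U * Matrix.diagonal (fun j => d (Fin.castLE hk j)) * (firstCols hk U)ᵀ

/-- The law of an `m × r` matrix with i.i.d. `N(0, 1/r)` entries. -/
def sketchLaw (m r : ℕ) : Measure (Fin m → Fin r → ℝ) :=
  Measure.pi fun _ => Measure.pi fun _ => gaussianReal 0 (r : ℝ≥0)⁻¹

/-- `Q` is a possible output of the sketching procedure for the data matrix `X` and the random
matrix `Ω`: `P` is the orthonormal factor of `XΩ`, the columns of `U` are the left singular vectors
of `Y = Pᵀ X` (eigenvectors of `Y Yᵀ`) for decreasing singular values, and `Q = P U_k`.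
If `XΩ` has rank `r`, the conditions on `P` say that its columns are an orthonormal basis of the
column space of `XΩ`; if `XΩ` is rank deficient, both an orthonormal basis of the column space and
the (possibly larger) orthonormal factor returned by a thin QR factorization are admitted. -/
def IsSketch {n m r k : ℕ} (X : Matrix (Fin n) (Fin m) ℝ) (Ω : Matrix (Fin m) (Fin r) ℝ)
    (Q : Matrix (Fin n) (Fin k) ℝ) : Prop :=
  ∃ (s : ℕ) (hk : k ≤ s) (P : Matrix (Fin n) (Fin s) ℝ) (U : Matrix (Fin s) (Fin s) ℝ)
    (d : Fin s → ℝ),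
    s ≤ r ∧ Pᵀ * P = 1 ∧
    LinearMap.range (X * Ω).mulVecLin ≤ LinearMap.range P.mulVecLin ∧
    IsSortedEigendecomposition ((Pᵀ * X) * (Pᵀ * X)ᵀ) U d ∧
    Q = P * firstCols hk U

/-- The compressed correlation matrix `C̃ = Qᵀ C Q`. -/
def compressed {n k : ℕ} (C : Matrix (Fin n) (Fin n) ℝ) (Q : Matrix (Fin n) (Fin k) ℝ) :
    Matrix (Fin k) (Fin k) ℝ :=
  Qᵀ * C * Q

/-- The conditioner `A = Q B Qᵀ + a (I - Q Qᵀ)`. -/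
def conditioner {n k : ℕ} (Q : Matrix (Fin n) (Fin k) ℝ) (B : Matrix (Fin k) (Fin k) ℝ) (a : ℝ) :
    Matrix (Fin n) (Fin n) ℝ :=
  Q * B * Qᵀ + a • (1 - Q * Qᵀ)

theorem conditioner_mul_conditioner {n k : ℕ} (Q : Matrix (Fin n) (Fin k) ℝ)
    (B : Matrix (Fin k) (Fin k) ℝ) (a : ℝ) (hQ : Qᵀ * Q = 1) (hB : IsUnit B.det) (ha : a ≠ 0) :
    conditioner Q B a * conditioner Q B⁻¹ a⁻¹ = 1 := by
  have h1 : Q * B * Qᵀ * (Q * B⁻¹ * Qᵀ) = Q * Qᵀ := by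
    calc Q * B * Qᵀ * (Q * B⁻¹ * Qᵀ) = Q * B * (Qᵀ * Q) * B⁻¹ * Qᵀ := by
          simp only [Matrix.mul_assoc]
      _ = Q * (B * B⁻¹) * Qᵀ := by rw [hQ, Matrix.mul_one, Matrix.mul_assoc Q B]
      _ = Q * Qᵀ := by rw [Matrix.mul_nonsing_inv B hB, Matrix.mul_one]
  have h2 : Q * B * Qᵀ * (1 - Q * Qᵀ) = 0 := by
    rw [Matrix.mul_sub, Matrix.mul_one, ← Matrix.mul_assoc, Matrix.mul_assoc (Q * B) Qᵀ Q, hQ,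
      Matrix.mul_one, sub_self]
  have h3 : (1 - Q * Qᵀ) * (Q * B⁻¹ * Qᵀ) = 0 := by
    rw [Matrix.sub_mul, Matrix.one_mul]
    have : Q * Qᵀ * (Q * B⁻¹ * Qᵀ) = Q * (Qᵀ * Q) * B⁻¹ * Qᵀ := by
      simp only [Matrix.mul_assoc]
    rw [this, hQ, Matrix.mul_one, sub_self]
  have h4 : (1 - Q * Qᵀ) * (1 - Q * Qᵀ) = 1 - Q * Qᵀ := by
    have : Q * Qᵀ * (Q * Qᵀ) = Q * Qᵀ := by
      rw [Matrix.mul_assoc, ← Matrix.mul_assoc Qᵀ, hQ, Matrix.one_mul]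
    rw [Matrix.sub_mul, Matrix.mul_sub, Matrix.mul_sub, this]
    simp
  unfold conditioner
  rw [Matrix.add_mul, Matrix.mul_add, Matrix.mul_add, h1, Matrix.mul_smul, h2, Matrix.smul_mul, h3,
    Matrix.smul_mul, Matrix.mul_smul, h4, smul_smul, mul_inv_cancel₀ ha]
  simp

/-- The inverse conditioner `Ã⁻¹ = Q B⁻¹ Qᵀ + a⁻¹ (I - Q Qᵀ)`, in the factored form in which it is
output and applied, with `B = C̃^{1/2}` and `a⁻¹ = √((n-k) / (tr C - tr C̃))`.
If `tr C = tr C̃`, then `(I - Q Qᵀ) x_i = 0` for every instance, so the value of `a⁻¹`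
(here `0`) plays no role in the updates. -/
def sketchedInv {n k : ℕ} (C : Matrix (Fin n) (Fin n) ℝ) (Q : Matrix (Fin n) (Fin k) ℝ) :
    Matrix (Fin n) (Fin n) ℝ :=
  conditioner Q (psdSqrt (compressed C Q))⁻¹
    (Real.sqrt (((n : ℝ) - k) / (C.trace - (compressed C Q).trace)))

/-- The prediction `W x` as a Euclidean vector. -/
def predict {p n : ℕ} (W : Matrix (Fin p) (Fin n) ℝ) (v : Fin n → ℝ) : EuclideanSpace ℝ (Fin p) :=
  WithLp.toLp 2 (W *ᵥ v)

/-- The empirical loss `L(W) = (1/m) ∑ ℓ_i (W x_i)`; here `ℓ i` stands for `ℓ_{y_i}`. -/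
def empLoss {p n m : ℕ} (x : Fin m → Fin n → ℝ) (ℓ : Fin m → EuclideanSpace ℝ (Fin p) → ℝ)
    (W : Matrix (Fin p) (Fin n) ℝ) : ℝ :=
  (m : ℝ)⁻¹ * ∑ i, ℓ i (predict W (x i))

/-- `g` selects a subgradient of `f` at every point. -/
def IsSubgradientSelection {p : ℕ} (f : EuclideanSpace ℝ (Fin p) → ℝ)
    (g : EuclideanSpace ℝ (Fin p) → EuclideanSpace ℝ (Fin p)) : Prop :=
  ∀ a b, f a + inner ℝ (g a) (b - a) ≤ f b

/-- Conditioned SGD, started at `0`, with learning rate `η`, inverse conditioner `Ainv` and drawn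
indices `i`: `W ← W - η (∇ℓ_i (W x_i)) (A⁻¹ x_i)ᵀ`. The `t`-th value is the iterate
after `t` updates. -/
def iterate {p n m T : ℕ} (x : Fin m → Fin n → ℝ)
    (g : Fin m → EuclideanSpace ℝ (Fin p) → EuclideanSpace ℝ (Fin p)) (η : ℝ)
    (Ainv : Matrix (Fin n) (Fin n) ℝ) (i : Fin T → Fin m) : ℕ → Matrix (Fin p) (Fin n) ℝ
  | 0 => 0
  | t + 1 =>
    if h : t < T then
      iterate x g η Ainv i t -
        η • Matrix.vecMulVec
          (g (i ⟨t, h⟩) (predict (iterate x g η Ainv i t) (x (i ⟨t, h⟩)))).ofLp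
          (Ainv *ᵥ x (i ⟨t, h⟩))
    else iterate x g η Ainv i t

/-- The averaged iterate `W̄ = (1/T) ∑_{t=1}^T W_t` (the first iterate being `0`). -/
def averaged {p n m T : ℕ} (x : Fin m → Fin n → ℝ)
    (g : Fin m → EuclideanSpace ℝ (Fin p) → EuclideanSpace ℝ (Fin p)) (η : ℝ)
    (Ainv : Matrix (Fin n) (Fin n) ℝ) (i : Fin T → Fin m) : Matrix (Fin p) (Fin n) ℝ :=
  (T : ℝ)⁻¹ • ∑ t ∈ Finset.range T, iterate x g η Ainv i t

/-- The expectation of `L(W̄) - L(W⋆)` over indices drawn independently and uniformly from the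
`m` examples, for a fixed conditioner. -/
def expectedGap {p n m : ℕ} (x : Fin m → Fin n → ℝ) (ℓ : Fin m → EuclideanSpace ℝ (Fin p) → ℝ)
    (g : Fin m → EuclideanSpace ℝ (Fin p) → EuclideanSpace ℝ (Fin p)) (η : ℝ) (T : ℕ)
    (Ainv : Matrix (Fin n) (Fin n) ℝ) (Wstar : Matrix (Fin p) (Fin n) ℝ) : ℝ :=
  ((m : ℝ) ^ T)⁻¹ * ∑ i : Fin T → Fin m,
    (empLoss x ℓ (averaged x g η Ainv i) - empLoss x ℓ Wstar)

end SCSGD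

end

/-! Fix the sketch first. The usual SGD potential argument, run in the norm `‖W‖_A² = tr(W A Wᵀ)`,
bounds the expected gap by `tr(W⋆ A W⋆ᵀ)/(2ηT) + (ηρ²/2) tr(A⁻¹C)`. For the conditioner built from
`Q`, write `s = tr C̃^{1/2}` and `τ = √((n-k)(tr C - tr C̃))`. The choice of `a` gives `tr A =
tr(A⁻¹C) = s + τ`, and the step size balances the two terms, so the gap is at most `σρ/√T · (s + τ)`
(`expectedGap_le`).

Two deterministic facts compare this with the spectrum of `C`. A Ky Fan argument gives `s ≤ tr
C_k^{1/2}` (`sum_sqrt_compression_le`). For `τ`, let `V` hold the top `k` right singular vectors of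
`X`, `S = X - XVVᵀ`, and `H` a right inverse of `VᵀΩ`. Since `XΩHVᵀ` has its columns in the range of
`P`, comparing it with the optimal rank-`k` choice in that range yields `m(tr C - tr C̃) ≤ ‖S‖² +
‖SΩH‖²` in Frobenius norm (`IsSketch.spec`), where `‖S‖² = m(tr C - tr C_k)`
(`exists_rightSingular`).

The expectation over `Ω` remains. Since `SV = 0`, the matrices `VᵀΩ` and `SΩ` are independent
Gaussians; conditionally on the first, `E‖SΩH‖² = ‖S‖²‖H‖²/r`. By Jensen it suffices that `E‖H‖ ≤
K₀√r` for the pseudoinverse `H` of a `k × r` Gaussian matrix (`lintegral_frob_rightInv_le`). Here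
`‖H‖²` is the sum of the diagonal entries of the inverse Gram matrix, each dominated by an inverse
`χ²` variable with `r - k + 1` degrees of freedom. With at least three degrees its mean is finite.
With two, that is `r = k + 1`, the mean is infinite, but its square root is integrable and `r ≥ ck`
forces `k ≤ 1/(c-1)`. This is why first moments of norms, and not second moments, are estimated
throughout.

The comparison with `tr C^{1/2}` is Cauchy–Schwarz on the `n - k` smallest eigenvalues. -/

namespace SCSGD

/-! ### Frobenius norms and Ky Fan type inequalities -/

section LinearAlgebra

/-- The squared Frobenius norm of a matrix. -/
def frobSq {ι κ : Type*} [Fintype ι] [Fintype κ] (M : Matrix ι κ ℝ) : ℝ := (Mᵀ * M).trace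

variable {ι κ κ' : Type*} [Fintype ι] [Fintype κ] [Fintype κ']

theorem frobSq_eq_sum (M : Matrix ι κ ℝ) : frobSq M = ∑ i, ∑ j, M i j ^ 2 := by
  rw [Finset.sum_comm]
  simp [frobSq, Matrix.trace, Matrix.mul_apply, pow_two]

theorem frobSq_nonneg (M : Matrix ι κ ℝ) : 0 ≤ frobSq M := by
  rw [frobSq_eq_sum]; positivity

theorem frobSq_transpose (M : Matrix ι κ ℝ) : frobSq Mᵀ = frobSq M := by
  simp only [frobSq_eq_sum, Matrix.transpose_apply]
  exact Finset.sum_comm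

theorem frobSq_eq_zero {M : Matrix ι κ ℝ} (h : frobSq M = 0) : M = 0 := by
  rw [frobSq_eq_sum, Finset.sum_eq_zero_iff_of_nonneg (fun i _ => by positivity)] at h
  ext i j
  have := h i (Finset.mem_univ _)
  rw [Finset.sum_eq_zero_iff_of_nonneg (fun i _ => by positivity)] at this
  simpa using this j (Finset.mem_univ _)

theorem frobSq_of_isometry_mul [DecidableEq κ] {P : Matrix ι κ ℝ} (hP : Pᵀ * P = 1)
    (M : Matrix κ κ' ℝ) : frobSq (P * M) = frobSq M := by
  unfold frobSq
  rw [Matrix.transpose_mul, Matrix.mul_assoc, ← Matrix.mul_assoc Pᵀ, hP, Matrix.one_mul]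

/-- The hypothesis makes `N` a partial isometry: `NᵀN` is an orthogonal projection, so `‖v‖² - ‖Nv‖²
= ‖v - NᵀNv‖²`. This one form serves coisometries, transposes of isometries and rank-deficient
normalised factors. -/
theorem dotProduct_mulVec_self_le {N : Matrix ι κ ℝ} (hN : N * Nᵀ * N = N) (v : κ → ℝ) :
    (N *ᵥ v) ⬝ᵥ (N *ᵥ v) ≤ v ⬝ᵥ v := by
  have h1 : Nᵀ *ᵥ (N *ᵥ v) ⬝ᵥ v = (N *ᵥ v) ⬝ᵥ (N *ᵥ v) := by
    rw [Matrix.mulVec_transpose, Matrix.dotProduct_mulVec]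
  have h2 : Nᵀ *ᵥ (N *ᵥ v) ⬝ᵥ Nᵀ *ᵥ (N *ᵥ v) = (N *ᵥ v) ⬝ᵥ (N *ᵥ v) := by
    rw [Matrix.mulVec_transpose, ← Matrix.dotProduct_mulVec, ← Matrix.mulVec_transpose,
      Matrix.mulVec_mulVec, Matrix.mulVec_mulVec, hN]
  have h3 : 0 ≤ (v - Nᵀ *ᵥ (N *ᵥ v)) ⬝ᵥ (v - Nᵀ *ᵥ (N *ᵥ v)) :=
    Finset.sum_nonneg fun i _ => mul_self_nonneg _
  rw [sub_dotProduct, dotProduct_sub, dotProduct_sub, h2, h1,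
    dotProduct_comm v (Nᵀ *ᵥ (N *ᵥ v)), h1] at h3
  linarith

theorem frobSq_eq_sum_col (M : Matrix ι κ ℝ) : frobSq M = ∑ j, M.col j ⬝ᵥ M.col j := by
  rw [frobSq_eq_sum, Finset.sum_comm]
  simp [dotProduct, pow_two]

theorem frobSq_mul_le {N : Matrix ι κ ℝ} (hN : N * Nᵀ * N = N) (V : Matrix κ κ' ℝ) :
    frobSq (N * V) ≤ frobSq V := by
  rw [frobSq_eq_sum_col, frobSq_eq_sum_col]
  refine Finset.sum_le_sum fun j _ => ?_
  exact dotProduct_mulVec_self_le hN (V.col j)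

theorem sum_castLE {k s : ℕ} (hk : k ≤ s) (f : Fin s → ℝ) :
    ∑ j : Fin k, f (Fin.castLE hk j) = ∑ i : Fin s, if (i : ℕ) < k then f i else 0 := by
  obtain ⟨l, rfl⟩ := Nat.exists_eq_add_of_le hk
  rw [Fin.sum_univ_add]
  have h : ∀ i : Fin k, Fin.castLE hk i = Fin.castAdd l i := fun i => rfl
  simp [h]

/-- Fractional knapsack: with total weight `k` and at most `1` per item, filling the `k` largest
coefficients is optimal. Subtracting the threshold `τ`, the `k`-th coefficient, makes the comparison
termwise; `τ ≥ 0` absorbs a total weight below `k`. -/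
theorem sum_mul_le_sum_castLE {k s : ℕ} (hk1 : 1 ≤ k) (hk : k ≤ s) {d w : Fin s → ℝ}
    (hd : Antitone d) (hd0 : ∀ i, 0 ≤ d i) (hw0 : ∀ i, 0 ≤ w i) (hw1 : ∀ i, w i ≤ 1)
    (hw : ∑ i, w i ≤ k) : ∑ i, d i * w i ≤ ∑ j : Fin k, d (Fin.castLE hk j) := by
  set τ := d ⟨k - 1, by omega⟩ with hτ
  have h1 : ∑ i, (d i - τ) * w i ≤ ∑ i : Fin s, if (i : ℕ) < k then d i - τ else 0 := by
    refine Finset.sum_le_sum fun i _ => ?_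
    split_ifs with h
    · have : τ ≤ d i := hd (by rw [Fin.le_def]; simp; omega)
      nlinarith [hw1 i]
    · have : d i ≤ τ := hd (by rw [Fin.le_def]; simp; omega)
      nlinarith [hw0 i]
  rw [← sum_castLE hk (fun i => d i - τ)] at h1
  simp only [sub_mul, Finset.sum_sub_distrib, ← Finset.mul_sum, Finset.sum_const, Finset.card_univ,
    Fintype.card_fin, nsmul_eq_mul] at h1
  nlinarith [hd0 ⟨k - 1, by omega⟩, mul_le_mul_of_nonneg_left hw (hd0 ⟨k - 1, by omega⟩)]

theorem sum_sq_row_le_one [DecidableEq ι] [DecidableEq κ] {N : Matrix ι κ ℝ} (hN : Nᵀ * N = 1)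
    (i : ι) : ∑ b, N i b ^ 2 ≤ 1 := by
  have h : Nᵀ * Nᵀᵀ * Nᵀ = Nᵀ := by
    rw [Matrix.transpose_transpose, hN, Matrix.one_mul]
  have := dotProduct_mulVec_self_le h (Pi.single i 1)
  simpa [pow_two, Pi.single_apply, dotProduct] using this

theorem frobSq_of_isometry [DecidableEq κ] {N : Matrix ι κ ℝ} (hN : Nᵀ * N = 1) :
    frobSq N = Fintype.card κ := by
  rw [frobSq, hN, Matrix.trace_one]

/-- Ky Fan's inequality in the eigenbasis. -/
theorem sum_mul_sum_sq_le {k n : ℕ} (hk1 : 1 ≤ k) (hk : k ≤ n) {N : Matrix (Fin n) (Fin k) ℝ}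
    (hN : Nᵀ * N = 1) {s : Fin n → ℝ} (hs : Antitone s) (hs0 : ∀ i, 0 ≤ s i) :
    ∑ i, s i * ∑ b, N i b ^ 2 ≤ ∑ j : Fin k, s (Fin.castLE hk j) := by
  refine sum_mul_le_sum_castLE hk1 hk hs hs0 (fun i => by positivity)
    (sum_sq_row_le_one hN) ?_
  rw [← frobSq_eq_sum, frobSq_of_isometry hN]
  simp

/-- The sum of the square roots of the eigenvalues of a compression is at most the sum of the
largest `k` square roots. -/
theorem sum_sqrt_compression_le {k n : ℕ} (hk1 : 1 ≤ k) (hk : k ≤ n)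
    {N : Matrix (Fin n) (Fin k) ℝ} (hN : Nᵀ * N = 1) {d : Fin n → ℝ} (hd : Antitone d)
    (hd0 : ∀ i, 0 ≤ d i) {μ : Fin k → ℝ} (hμ : ∀ j, 0 < μ j)
    (h : Nᵀ * Matrix.diagonal d * N = Matrix.diagonal μ) :
    ∑ j, √(μ j) ≤ ∑ j : Fin k, √(d (Fin.castLE hk j)) := by
  -- `Z = D^{1/2} N M^{-1/2}`, with `M` the compression, is again an isometry, and `∑ √μ = tr(Zᵀ
  -- D^{1/2} N)`. AM-GM splits this into two quadratic expressions, one in `Z` and one in `N`, and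
  -- Ky Fan bounds each.
  set Z : Matrix (Fin n) (Fin k) ℝ :=
    Matrix.diagonal (fun i => √(d i)) * N * Matrix.diagonal (fun j => (√(μ j))⁻¹) with hZ
  have hdd : Matrix.diagonal (fun i => √(d i)) * Matrix.diagonal (fun i => √(d i))
      = Matrix.diagonal d := by
    rw [Matrix.diagonal_mul_diagonal]
    congr 1; ext i; exact Real.mul_self_sqrt (hd0 i)
  have hZZ : Zᵀ * Z = 1 := by
    rw [hZ]
    simp only [Matrix.transpose_mul, Matrix.diagonal_transpose]
    calc _ = Matrix.diagonal (fun j => (√(μ j))⁻¹) * (Nᵀ * (Matrix.diagonal (fun i => √(d i)) *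
          Matrix.diagonal (fun i => √(d i))) * N) * Matrix.diagonal (fun j => (√(μ j))⁻¹) := by
          simp only [Matrix.mul_assoc]
      _ = 1 := by
          rw [hdd, h, Matrix.diagonal_mul_diagonal, Matrix.diagonal_mul_diagonal,
            ← Matrix.diagonal_one]
          congr 1; ext j
          have := Real.sqrt_pos.2 (hμ j)
          have h2 := Real.mul_self_sqrt (hμ j).le
          field_simp
          nlinarith
  have hs : Antitone fun i => √(d i) := fun i j hij => Real.sqrt_le_sqrt (hd hij)
  have hs0 : ∀ i, 0 ≤ √(d i) := fun i => Real.sqrt_nonneg _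
  have h1 := sum_mul_sum_sq_le hk1 hk hN hs hs0
  have h2 := sum_mul_sum_sq_le hk1 hk hZZ hs hs0
  have h3 : ∑ j, √(μ j) = ∑ i, √(d i) * ∑ b, Z i b * N i b := by
    have h4 : ∀ j, μ j = ∑ i, N i j * d i * N i j := fun j => by
      have := congrFun (congrFun h j) j
      rw [Matrix.diagonal_apply_eq, Matrix.mul_apply] at this
      rw [← this]
      simp [Matrix.mul_diagonal]
    simp only [Finset.mul_sum]
    rw [Finset.sum_comm]
    refine Finset.sum_congr rfl fun j _ => ?_
    have h5 : ∀ i, √(d i) * (Z i j * N i j) = (√(μ j))⁻¹ * (N i j * d i * N i j) := fun i => by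
      have : Z i j = √(d i) * N i j * (√(μ j))⁻¹ := by
        simp [hZ, Matrix.mul_diagonal, Matrix.diagonal_mul]
      rw [this]
      linear_combination (√(μ j))⁻¹ * N i j * N i j * Real.mul_self_sqrt (hd0 i)
    simp only [h5]
    rw [← Finset.mul_sum, ← h4, inv_mul_eq_div, Real.div_sqrt]
  have h6 : ∑ i, √(d i) * ∑ b, Z i b * N i b ≤
      ∑ i, (√(d i) * (∑ b, Z i b ^ 2) / 2 + √(d i) * (∑ b, N i b ^ 2) / 2) := by
    refine Finset.sum_le_sum fun i _ => ?_
    rw [← add_div, ← mul_add, mul_div_assoc, ← Finset.sum_add_distrib, Finset.sum_div]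
    refine mul_le_mul_of_nonneg_left (Finset.sum_le_sum fun b _ => ?_) (hs0 i)
    nlinarith [sq_nonneg (Z i b - N i b)]
  rw [Finset.sum_add_distrib, ← Finset.sum_div, ← Finset.sum_div] at h6
  linarith

/-- `‖Y V‖²` for an isometry `V` is at most the sum of the `k` largest eigenvalues of `Y Yᵀ`. -/
theorem frobSq_mul_isometry_le {s m k : ℕ} (hk1 : 1 ≤ k) (hk : k ≤ s)
    {Y : Matrix (Fin s) (Fin m) ℝ} {U : Matrix (Fin s) (Fin s) ℝ} {d : Fin s → ℝ}
    (h : IsSortedEigendecomposition (Y * Yᵀ) U d) {V : Matrix (Fin m) (Fin k) ℝ}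
    (hV : Vᵀ * V = 1) : frobSq (Y * V) ≤ ∑ j : Fin k, d (Fin.castLE hk j) := by
  have hU' : U * Uᵀ = 1 := mul_eq_one_comm.1 h.orthogonal
  set Λ := Uᵀ * Y with hΛ
  have hΛΛ : Λ * Λᵀ = Matrix.diagonal d := by
    rw [hΛ, Matrix.transpose_mul, Matrix.transpose_transpose]
    calc _ = Uᵀ * (Y * Yᵀ) * U := by simp only [Matrix.mul_assoc]
      _ = (Uᵀ * U) * Matrix.diagonal d * (Uᵀ * U) := by rw [h.eq]; simp only [Matrix.mul_assoc]
      _ = _ := by rw [h.orthogonal, Matrix.one_mul, Matrix.mul_one]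
  have hrow : ∀ i, d i = ∑ j, Λ i j ^ 2 := fun i => by
    have := congrFun (congrFun hΛΛ i) i
    rw [Matrix.diagonal_apply_eq, Matrix.mul_apply] at this
    rw [← this]
    simp [pow_two]
  have hd0 : ∀ i, 0 ≤ d i := fun i => by rw [hrow]; positivity
  -- The rows of `Λ` are orthogonal with squared norms `d i`. Normalising them, with `0⁻¹ = 0` for
  -- the zero rows, gives a partial isometry.
  set N : Matrix (Fin s) (Fin m) ℝ := Matrix.diagonal (fun i => (√(d i))⁻¹) * Λ with hN
  have hNN : N * Nᵀ = Matrix.diagonal (fun i => (√(d i))⁻¹ * d i * (√(d i))⁻¹) := by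
    rw [hN, Matrix.transpose_mul, Matrix.diagonal_transpose]
    calc _ = Matrix.diagonal (fun i => (√(d i))⁻¹) * (Λ * Λᵀ) *
          Matrix.diagonal (fun i => (√(d i))⁻¹) := by simp only [Matrix.mul_assoc]
      _ = _ := by rw [hΛΛ, Matrix.diagonal_mul_diagonal, Matrix.diagonal_mul_diagonal]
  have hscal : ∀ i, (√(d i))⁻¹ * d i * (√(d i))⁻¹ * (√(d i))⁻¹ = (√(d i))⁻¹ := fun i => by
    rcases eq_or_ne (√(d i)) 0 with h0 | h0
    · simp [h0]
    · have := Real.mul_self_sqrt (hd0 i)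
      field_simp
      nlinarith
  have hNNN : N * Nᵀ * N = N := by
    rw [hNN, hN, ← Matrix.mul_assoc, Matrix.diagonal_mul_diagonal]
    simp only [hscal]
  have hΛN : ∀ i j, Λ i j = √(d i) * N i j := fun i j => by
    rw [hN, Matrix.diagonal_mul]
    rcases eq_or_ne (√(d i)) 0 with h0 | h0
    · have : d i = 0 := (Real.sqrt_eq_zero (hd0 i)).1 h0
      rw [hrow, Finset.sum_eq_zero_iff_of_nonneg (fun i _ => by positivity)] at this
      have h1 := this j (Finset.mem_univ _)
      rw [h0]; simpa using h1
    · field_simp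
  have hΛV : ∀ i b, (Λ * V) i b = √(d i) * (N * V) i b := fun i b => by
    simp only [Matrix.mul_apply, Finset.mul_sum, hΛN, mul_assoc]
  have e1 : frobSq (Y * V) = ∑ i, d i * ∑ b, (N * V) i b ^ 2 := by
    rw [← frobSq_of_isometry_mul (P := Uᵀ) (by rw [Matrix.transpose_transpose, hU']) (Y * V),
      ← Matrix.mul_assoc, frobSq_eq_sum]
    refine Finset.sum_congr rfl fun i _ => ?_
    rw [Finset.mul_sum]
    refine Finset.sum_congr rfl fun b _ => ?_
    rw [hΛV, mul_pow, Real.sq_sqrt (hd0 i)]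
  rw [e1]
  have hVT : Vᵀ * Vᵀᵀ * Vᵀ = Vᵀ := by rw [Matrix.transpose_transpose, hV, Matrix.one_mul]
  -- The weights are the squared row norms of `N V`: each is at most `1` because `Vᵀ` contracts the
  -- rows of `N`, and their sum is at most `‖V‖² = k` because `N` contracts the columns of `V`.
  refine sum_mul_le_sum_castLE hk1 hk h.sorted hd0 (fun i => by positivity) (fun i => ?_) ?_
  · have a1 := dotProduct_mulVec_self_le hVT (N.row i)
    have a2 : N.row i ⬝ᵥ N.row i = (N * Nᵀ) i i := by
      simp [dotProduct, Matrix.mul_apply]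
    have a3 : (N * Nᵀ) i i ≤ 1 := by
      rw [hNN, Matrix.diagonal_apply_eq]
      rcases eq_or_ne (√(d i)) 0 with h0 | h0
      · simp [h0]
      · have := Real.mul_self_sqrt (hd0 i)
        field_simp
        nlinarith
    have a4 : (Vᵀ *ᵥ N.row i) ⬝ᵥ (Vᵀ *ᵥ N.row i) = ∑ b, (N * V) i b ^ 2 := by
      simp only [dotProduct, Matrix.mulVec, Matrix.mul_apply, pow_two, Matrix.transpose_apply,
        Matrix.row]
      refine Finset.sum_congr rfl fun b _ => ?_
      simp only [mul_comm (V _ b)]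
    linarith
  · rw [← frobSq_eq_sum]
    refine (frobSq_mul_le hNNN V).trans ?_
    rw [frobSq_of_isometry hV]; simp

/-- If the eigenvalue at `j < k` vanished, sorting would make all later ones vanish too, leaving
rank at most `j`. -/
theorem diag_pos_of_rank {s k : ℕ} (hk : k ≤ s) {M U : Matrix (Fin s) (Fin s) ℝ} {d : Fin s → ℝ}
    (h : IsSortedEigendecomposition M U d) (hd0 : ∀ i, 0 ≤ d i) (hr : k ≤ M.rank) (j : Fin k) :
    0 < d (Fin.castLE hk j) := by
  by_contra hj
  have hz : ∀ i : Fin s, (j : ℕ) ≤ i → d i = 0 := fun i hi =>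
    le_antisymm ((h.sorted (by rw [Fin.le_def]; simpa using hi)).trans (not_lt.1 hj)) (hd0 i)
  have h1 : M.rank ≤ (Matrix.diagonal d).rank := by
    rw [h.eq]
    exact (Matrix.rank_mul_le_left _ _).trans (Matrix.rank_mul_le_right _ _)
  rw [Matrix.rank_diagonal] at h1
  have h2 : Fintype.card {i // d i ≠ 0} ≤ Fintype.card (Fin j) := by
    refine Fintype.card_le_of_injective
      (fun i => ⟨i.1, by by_contra hc; exact i.2 (hz _ (not_lt.1 hc))⟩) ?_
    intro a b hab
    simpa [Subtype.ext_iff, Fin.ext_iff] using hab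
  rw [Fintype.card_fin] at h2
  have := j.2
  omega

end LinearAlgebra

/-! ### Square roots in an eigenbasis and the deterministic sketching error -/

section Eigendecomposition

-- Conjugation by `V` diagonalises every polynomial in `M`. The spectrum lies among the `d i`, and
-- there the square root agrees with its Lagrange interpolant, so the continuous functional calculus
-- reduces to the polynomial one.
open Polynomial in
theorem psdSqrt_eq {n : ℕ} {M V : Matrix (Fin n) (Fin n) ℝ} {d : Fin n → ℝ} (hV : Vᵀ * V = 1)
    (hM : M = V * Matrix.diagonal d * Vᵀ) :
    psdSqrt M = V * Matrix.diagonal (fun i => √(d i)) * Vᵀ := by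
  have hV' : V * Vᵀ = 1 := mul_eq_one_comm.1 hV
  have hpow : ∀ q : ℝ[X], aeval M q = V * Matrix.diagonal (fun i => q.eval (d i)) * Vᵀ := by
    intro q
    induction q using Polynomial.induction_on' with
    | add p q hp hq =>
      rw [map_add, hp, hq, ← Matrix.add_mul, ← Matrix.mul_add, Matrix.diagonal_add]
      simp
    | monomial l a =>
      have h1 : ∀ l : ℕ, M ^ l = V * Matrix.diagonal (fun i => d i ^ l) * Vᵀ := by
        intro l
        induction l with
        | zero => simp [hV']
        | succ l ih =>
          rw [pow_succ, ih, hM]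
          calc _ = V * Matrix.diagonal (fun i => d i ^ l) * (Vᵀ * V) * Matrix.diagonal d * Vᵀ := by
                simp only [Matrix.mul_assoc]
            _ = _ := by
                rw [hV, Matrix.mul_one, Matrix.mul_assoc V, Matrix.diagonal_mul_diagonal]
                simp only [pow_succ]
      rw [aeval_monomial, h1]
      simp only [eval_monomial]
      have : Matrix.diagonal (fun i => a * d i ^ l) = a • Matrix.diagonal (fun i => d i ^ l) := by
        ext i j
        by_cases hij : i = j
        · subst hij; simp
        · simp [hij]
      rw [this, Matrix.mul_smul, Matrix.smul_mul, Algebra.algebraMap_eq_smul_one, smul_mul_assoc,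
        one_mul]
  have hsa : IsSelfAdjoint M := by
    rw [IsSelfAdjoint, Matrix.star_eq_conjTranspose, Matrix.conjTranspose_eq_transpose_of_trivial,
      hM]
    simp [Matrix.mul_assoc]
  have hspec : ∀ t ∈ spectrum ℝ M, ∃ i, t = d i := by
    intro t ht
    by_contra hne
    push Not at hne
    -- This product annihilates `M`, so by spectral mapping every spectral value is one of its
    -- roots.
    have h0 := hpow (∏ i : Fin n, (X - C (d i)))
    have h1 : (fun i => (∏ i : Fin n, (X - C (d i))).eval (d i)) = fun _ => (0 : ℝ) := by
      ext i
      rw [eval_prod]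
      exact Finset.prod_eq_zero (Finset.mem_univ i) (by simp)
    rw [h1, Matrix.diagonal_zero, Matrix.mul_zero, Matrix.zero_mul] at h0
    have h2 := spectrum.subset_polynomial_aeval M (∏ i : Fin n, (X - C (d i))) ⟨t, ht, rfl⟩
    have : Nonempty (Fin n) := by
      by_contra hc
      rw [not_nonempty_iff] at hc
      rw [spectrum.of_subsingleton] at ht
      exact ht
    rw [h0, spectrum.zero_eq] at h2
    simp only [eval_prod, eval_sub, eval_X, eval_C, Set.mem_singleton_iff,
      Finset.prod_eq_zero_iff] at h2
    obtain ⟨i, -, hi⟩ := h2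
    exact hne i (sub_eq_zero.1 hi)
  set q := Lagrange.interpolate (Finset.univ.image d) id Real.sqrt with hq
  have hqd : ∀ i, q.eval (d i) = √(d i) := fun i => by
    rw [hq]
    exact Lagrange.eval_interpolate_at_node (v := id) Real.sqrt (Function.injective_id.injOn)
      (Finset.mem_image_of_mem d (Finset.mem_univ i))
  have : psdSqrt M = cfc q.eval M := by
    unfold psdSqrt
    refine cfc_congr fun t ht => ?_
    obtain ⟨i, rfl⟩ := hspec t ht
    exact (hqd i).symm
  rw [this, cfc_polynomial q M hsa, hpow]
  simp only [hqd]

theorem corr_eq {n m : ℕ} (x : Fin m → Fin n → ℝ) :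
    corr x = (m : ℝ)⁻¹ • (dataMatrix x * (dataMatrix x)ᵀ) := by
  unfold corr dataMatrix
  congr 1
  ext a b
  simp [Matrix.sum_apply, Matrix.vecMulVec_apply, Matrix.mul_apply]

theorem trace_mul_transpose_self {ι κ : Type*} [Fintype ι] [Fintype κ] (X : Matrix ι κ ℝ) :
    (X * Xᵀ).trace = frobSq X := by
  rw [frobSq, Matrix.trace_mul_comm]

theorem frobSq_sub {ι κ : Type*} [Fintype ι] [Fintype κ] (X Y : Matrix ι κ ℝ) :
    frobSq (X - Y) = frobSq X - 2 * (Xᵀ * Y).trace + frobSq Y := by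
  have h : (Yᵀ * X).trace = (Xᵀ * Y).trace := by
    rw [← Matrix.trace_transpose, Matrix.transpose_mul, Matrix.transpose_transpose]
  unfold frobSq
  rw [Matrix.transpose_sub, Matrix.sub_mul, Matrix.mul_sub, Matrix.mul_sub, Matrix.trace_sub,
    Matrix.trace_sub, Matrix.trace_sub, h]
  ring

theorem frobSq_mul_isometry_transpose {ι κ κ' : Type*} [Fintype ι] [Fintype κ] [Fintype κ']
    [DecidableEq κ] {V : Matrix κ' κ ℝ} (hV : Vᵀ * V = 1) (A : Matrix ι κ ℝ) :
    frobSq (A * Vᵀ) = frobSq A := by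
  rw [← frobSq_transpose, Matrix.transpose_mul, Matrix.transpose_transpose,
    frobSq_of_isometry_mul hV, frobSq_transpose]

/-- Pythagoras for the orthogonal projection `V Vᵀ` acting on the rows of `X`. -/
theorem frobSq_sub_mul_isometry {ι κ κ' : Type*} [Fintype ι] [Fintype κ] [Fintype κ']
    [DecidableEq κ] {V : Matrix κ' κ ℝ} (hV : Vᵀ * V = 1) (X : Matrix ι κ' ℝ) :
    frobSq (X - X * V * Vᵀ) = frobSq X - frobSq (X * V) := by
  rw [frobSq_sub, frobSq_mul_isometry_transpose hV]
  have : (Xᵀ * (X * V * Vᵀ)).trace = frobSq (X * V) := by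
    rw [← Matrix.mul_assoc, Matrix.trace_mul_comm, frobSq, Matrix.transpose_mul]
    simp only [Matrix.mul_assoc]
  rw [this]; ring

theorem mul_transpose_mul_of_range_le {n s r : ℕ} {P : Matrix (Fin n) (Fin s) ℝ}
    (hP : Pᵀ * P = 1) {M : Matrix (Fin n) (Fin r) ℝ}
    (h : LinearMap.range M.mulVecLin ≤ LinearMap.range P.mulVecLin) : P * (Pᵀ * M) = M := by
  refine Matrix.ext_of_mulVec_single fun j => ?_
  obtain ⟨w, hw⟩ := h ⟨Pi.single j 1, rfl⟩
  simp only [Matrix.mulVecLin_apply] at hw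
  rw [← Matrix.mulVec_mulVec, ← Matrix.mulVec_mulVec, ← hw, Matrix.mulVec_mulVec _ Pᵀ, hP,
    Matrix.one_mulVec]

theorem diag_nonneg_of_gram {s m : ℕ} {Y : Matrix (Fin s) (Fin m) ℝ}
    {U : Matrix (Fin s) (Fin s) ℝ} {d : Fin s → ℝ}
    (h : IsSortedEigendecomposition (Y * Yᵀ) U d) (i : Fin s) : 0 ≤ d i := by
  have hΛΛ : (Uᵀ * Y) * (Uᵀ * Y)ᵀ = Matrix.diagonal d := by
    rw [Matrix.transpose_mul, Matrix.transpose_transpose]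
    calc _ = Uᵀ * (Y * Yᵀ) * U := by simp only [Matrix.mul_assoc]
      _ = (Uᵀ * U) * Matrix.diagonal d * (Uᵀ * U) := by rw [h.eq]; simp only [Matrix.mul_assoc]
      _ = _ := by rw [h.orthogonal, Matrix.one_mul, Matrix.mul_one]
  have := congrFun (congrFun hΛΛ i) i
  rw [Matrix.diagonal_apply_eq, Matrix.mul_apply] at this
  rw [← this]
  exact Finset.sum_nonneg fun j _ => mul_self_nonneg _

theorem firstCols_isometry {s k : ℕ} (hk : k ≤ s) {U : Matrix (Fin s) (Fin s) ℝ}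
    (hU : Uᵀ * U = 1) : (firstCols hk U)ᵀ * firstCols hk U = 1 := by
  have : (firstCols hk U)ᵀ * firstCols hk U
      = (Uᵀ * U).submatrix (Fin.castLE hk) (Fin.castLE hk) := by
    ext i j
    simp [firstCols, Matrix.mul_apply]
  rw [this, hU, Matrix.submatrix_one _ (Fin.castLE_injective hk)]

theorem firstCols_compression {s k : ℕ} (hk : k ≤ s) {M U : Matrix (Fin s) (Fin s) ℝ}
    {d : Fin s → ℝ} (h : IsSortedEigendecomposition M U d) :
    (firstCols hk U)ᵀ * M * firstCols hk U = Matrix.diagonal fun j => d (Fin.castLE hk j) := by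
  have : (firstCols hk U)ᵀ * M * firstCols hk U
      = (Uᵀ * M * U).submatrix (Fin.castLE hk) (Fin.castLE hk) := by
    ext i j
    simp [firstCols, Matrix.mul_apply]
  have h2 : Uᵀ * M * U = Matrix.diagonal d := by
    calc _ = (Uᵀ * U) * Matrix.diagonal d * (Uᵀ * U) := by rw [h.eq]; simp only [Matrix.mul_assoc]
      _ = _ := by rw [h.orthogonal, Matrix.one_mul, Matrix.mul_one]
  rw [this, h2]
  exact Matrix.submatrix_diagonal _ _ (Fin.castLE_injective hk)

/-- The error of the sketched projection, compared with that of an oblique projection built from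
an isometry `V` and a right inverse `H` of `Vᵀ Ω`. -/
theorem IsSketch.spec {n m r k : ℕ} (hk1 : 1 ≤ k) {X : Matrix (Fin n) (Fin m) ℝ}
    {Ω : Matrix (Fin m) (Fin r) ℝ} {Q : Matrix (Fin n) (Fin k) ℝ} (h : IsSketch X Ω Q)
    {V : Matrix (Fin m) (Fin k) ℝ} (hV : Vᵀ * V = 1) {H : Matrix (Fin r) (Fin k) ℝ}
    (hH : Vᵀ * Ω * H = 1) (hrank : k ≤ (X * Ω * H).rank) :
    ∃ μ : Fin k → ℝ, (∀ j, 0 < μ j) ∧ Qᵀ * Q = 1 ∧ Qᵀ * (X * Xᵀ) * Q = Matrix.diagonal μ ∧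
      frobSq X - ∑ j, μ j ≤ frobSq (X - X * V * Vᵀ) + frobSq ((X - X * V * Vᵀ) * Ω * H) := by
  obtain ⟨s, hk, P, U, d, -, hP, hR, hE, rfl⟩ := h
  have hPX := mul_transpose_mul_of_range_le hP hR
  -- `A` holds the coordinates of `XΩH` in the orthonormal columns of `P`; the competitor to be
  -- compared with `X` is `P A Vᵀ = XΩHVᵀ`.
  set A := Pᵀ * (X * Ω) * H with hA
  have hPA : P * A = X * Ω * H := by rw [hA, ← Matrix.mul_assoc, hPX]
  have hrY : k ≤ ((Pᵀ * X) * (Pᵀ * X)ᵀ).rank := by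
    rw [Matrix.rank_self_mul_transpose]
    refine hrank.trans ?_
    rw [← hPA, hA]
    refine (Matrix.rank_mul_le_right _ _).trans ?_
    rw [← Matrix.mul_assoc, Matrix.mul_assoc]
    exact Matrix.rank_mul_le_left _ _
  have hd0 := diag_nonneg_of_gram hE
  refine ⟨fun j => d (Fin.castLE hk j), diag_pos_of_rank hk hE hd0 hrY, ?_, ?_, ?_⟩
  · rw [Matrix.transpose_mul, Matrix.mul_assoc, ← Matrix.mul_assoc Pᵀ, hP, Matrix.one_mul,
      firstCols_isometry hk hE.orthogonal]
  · rw [← firstCols_compression hk hE]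
    simp only [Matrix.transpose_mul, Matrix.transpose_transpose, Matrix.mul_assoc]
  · have h1 := frobSq_mul_isometry_le hk1 hk hE hV
    have h2 : frobSq (X - P * A * Vᵀ)
        = frobSq X - 2 * ((Pᵀ * X * V)ᵀ * A).trace + frobSq A := by
      rw [frobSq_sub, frobSq_mul_isometry_transpose hV, frobSq_of_isometry_mul hP]
      congr 3
      rw [← Matrix.mul_assoc, Matrix.trace_mul_comm, Matrix.transpose_mul, Matrix.transpose_mul,
        Matrix.transpose_transpose]
      simp only [Matrix.mul_assoc]
    -- Completing the square in `A`: `‖X - P A Vᵀ‖² ≥ ‖X‖² - ‖Pᵀ X V‖²`, and the last norm is at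
    -- most the sum of the `k` largest eigenvalues by `h1`.
    have h3 := frobSq_nonneg (Pᵀ * X * V - A)
    rw [frobSq_sub] at h3
    set S := X - X * V * Vᵀ with hS
    have hSV : S * V = 0 := by
      rw [hS, Matrix.sub_mul, Matrix.mul_assoc, hV, Matrix.mul_one, sub_self]
    -- Because `VᵀΩH = 1`, the component of `X` along `V` is reproduced exactly. The two remaining
    -- terms are orthogonal since `S V = 0`.
    have h4 : X - P * A * Vᵀ = S - S * Ω * H * Vᵀ := by
      have : S * Ω * H = P * A - X * V := by
        rw [hPA, hS, Matrix.sub_mul, Matrix.sub_mul]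
        congr 1
        calc _ = X * V * (Vᵀ * Ω * H) := by simp only [Matrix.mul_assoc]
          _ = _ := by rw [hH, Matrix.mul_one]
      rw [this, hS, Matrix.sub_mul]
      abel
    have h5 : frobSq (S - S * Ω * H * Vᵀ) = frobSq S + frobSq (S * Ω * H) := by
      rw [frobSq_sub, frobSq_mul_isometry_transpose hV]
      have : (Sᵀ * (S * Ω * H * Vᵀ)).trace = 0 := by
        rw [← Matrix.mul_assoc, Matrix.trace_mul_comm, ← Matrix.mul_assoc, ← Matrix.transpose_mul,
          hSV]
        simp
      rw [this]; ring
    rw [← h5, ← h4, h2]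
    linarith

end Eigendecomposition

/-! ### Spectral data of the correlation matrix -/

section Spectral

theorem corr_eq_gram {n m : ℕ} (x : Fin m → Fin n → ℝ) :
    corr x = ((√(m : ℝ))⁻¹ • dataMatrix x) * ((√(m : ℝ))⁻¹ • dataMatrix x)ᵀ := by
  rw [corr_eq, Matrix.transpose_smul, Matrix.smul_mul, Matrix.mul_smul, smul_smul, ← mul_inv,
    Real.mul_self_sqrt (Nat.cast_nonneg m)]

theorem corr_diag_nonneg {n m : ℕ} {x : Fin m → Fin n → ℝ} {U : Matrix (Fin n) (Fin n) ℝ}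
    {d : Fin n → ℝ} (hU : IsSortedEigendecomposition (corr x) U d) (i : Fin n) : 0 ≤ d i := by
  rw [corr_eq_gram] at hU
  exact diag_nonneg_of_gram hU i

theorem trace_conj_diagonal {ι κ : Type*} [Fintype ι] [Fintype κ] [DecidableEq κ]
    {V : Matrix ι κ ℝ} (hV : Vᵀ * V = 1) (d : κ → ℝ) :
    (V * Matrix.diagonal d * Vᵀ).trace = ∑ i, d i := by
  rw [Matrix.trace_mul_comm, ← Matrix.mul_assoc, hV, Matrix.one_mul, Matrix.trace_diagonal]

theorem truncation_trace {n k : ℕ} (hk : k ≤ n) {U : Matrix (Fin n) (Fin n) ℝ}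
    (hU : Uᵀ * U = 1) (d : Fin n → ℝ) :
    (truncation hk U d).trace = ∑ j : Fin k, d (Fin.castLE hk j) :=
  trace_conj_diagonal (firstCols_isometry hk hU) _

/-- Padding the diagonal with zeros keeps the square orthogonal factor, which is the form that
`psdSqrt_eq` needs. -/
theorem truncation_eq {n k : ℕ} (hk : k ≤ n) (U : Matrix (Fin n) (Fin n) ℝ) (d : Fin n → ℝ) :
    truncation hk U d
      = U * Matrix.diagonal (fun i : Fin n => if (i : ℕ) < k then d i else 0) * Uᵀ := by
  ext a b
  unfold truncation
  rw [Matrix.mul_apply, Matrix.mul_apply]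
  simp only [Matrix.mul_diagonal, firstCols, Matrix.submatrix_apply, id, Matrix.transpose_apply]
  rw [sum_castLE hk (fun i => U a i * d i * U b i)]
  refine Finset.sum_congr rfl fun i _ => ?_
  split_ifs <;> simp

theorem psdSqrt_truncation_trace {n k : ℕ} (hk : k ≤ n) {U : Matrix (Fin n) (Fin n) ℝ}
    (hU : Uᵀ * U = 1) (d : Fin n → ℝ) :
    (psdSqrt (truncation hk U d)).trace = ∑ j : Fin k, √(d (Fin.castLE hk j)) := by
  rw [psdSqrt_eq hU (truncation_eq hk U d), trace_conj_diagonal hU,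
    sum_castLE hk (fun i => √(d i))]
  refine Finset.sum_congr rfl fun i _ => ?_
  split_ifs <;> simp

/-- The leading right singular vectors of the data matrix. -/
theorem exists_rightSingular {n m k : ℕ} (hk : k ≤ n) (hm : 0 < m)
    {x : Fin m → Fin n → ℝ} {U : Matrix (Fin n) (Fin n) ℝ} {d : Fin n → ℝ}
    (hU : IsSortedEigendecomposition (corr x) U d) (hrank : k ≤ (corr x).rank) :
    ∃ V : Matrix (Fin m) (Fin k) ℝ, Vᵀ * V = 1 ∧
      frobSq (dataMatrix x - dataMatrix x * V * Vᵀ)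
        = m * ((corr x).trace - (truncation hk U d).trace) ∧
      ∀ (r : ℕ) (Ω : Matrix (Fin m) (Fin r) ℝ) (H : Matrix (Fin r) (Fin k) ℝ),
        Vᵀ * Ω * H = 1 → k ≤ (dataMatrix x * Ω * H).rank := by
  have hd0 := corr_diag_nonneg hU
  have hpos := diag_pos_of_rank hk hU hd0 hrank
  set Y : Matrix (Fin n) (Fin m) ℝ := (√(m : ℝ))⁻¹ • dataMatrix x with hY
  have hmR : 0 < √(m : ℝ) := Real.sqrt_pos.2 (by exact_mod_cast hm)
  have hXY : dataMatrix x = √(m : ℝ) • Y := by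
    rw [hY, smul_smul, mul_inv_cancel₀ hmR.ne', one_smul]
  have hC : corr x = Y * Yᵀ := corr_eq_gram x
  set D' : Matrix (Fin k) (Fin k) ℝ :=
    Matrix.diagonal fun j => (√(d (Fin.castLE hk j)))⁻¹ with hD'
  set Uk := firstCols hk U with hUk
  -- With `C = Y Yᵀ`, the right singular vectors are `Yᵀ U_k D_k^{-1/2}`; the rank assumption makes
  -- these `k` eigenvalues positive.
  set V : Matrix (Fin m) (Fin k) ℝ := Yᵀ * Uk * D' with hV
  have hVT : Vᵀ = D' * Ukᵀ * Y := by
    rw [hV, hD', Matrix.transpose_mul, Matrix.transpose_mul, Matrix.transpose_transpose,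
      Matrix.diagonal_transpose, Matrix.mul_assoc]
  have hVV : Vᵀ * V = 1 := by
    rw [hVT, hV]
    calc _ = D' * (Ukᵀ * (Y * Yᵀ) * Uk) * D' := by simp only [Matrix.mul_assoc]
      _ = 1 := by
          rw [← hC, hUk, firstCols_compression hk hU, hD', Matrix.diagonal_mul_diagonal,
            Matrix.diagonal_mul_diagonal, ← Matrix.diagonal_one]
          congr 1; ext j
          have h1 := Real.sqrt_pos.2 (hpos j)
          have h2 := Real.mul_self_sqrt (hpos j).le
          field_simp
          nlinarith
  refine ⟨V, hVV, ?_, fun r Ω H h => ?_⟩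
  · have hsq : IsSortedEigendecomposition (corr x * corr x) U (fun i => d i * d i) := by
      refine ⟨hU.orthogonal, fun i j hij => ?_, ?_⟩
      · exact mul_self_le_mul_self (hd0 j) (hU.sorted hij)
      · rw [hU.eq, ← Matrix.diagonal_mul_diagonal]
        calc _ = U * Matrix.diagonal d * (Uᵀ * U) * Matrix.diagonal d * Uᵀ := by
              simp only [Matrix.mul_assoc]
          _ = _ := by rw [hU.orthogonal, Matrix.mul_one]; simp only [Matrix.mul_assoc]
    have h1 : frobSq (Y * V) = ∑ j : Fin k, d (Fin.castLE hk j) := by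
      have : (Y * V)ᵀ * (Y * V) = D' * (Ukᵀ * (corr x * corr x) * Uk) * D' := by
        rw [Matrix.transpose_mul, hVT, hV, hC]
        simp only [Matrix.mul_assoc]
      rw [frobSq, this, hUk, firstCols_compression hk hsq, hD', Matrix.diagonal_mul_diagonal,
        Matrix.diagonal_mul_diagonal, Matrix.trace_diagonal]
      refine Finset.sum_congr rfl fun j _ => ?_
      have h1 := Real.sqrt_pos.2 (hpos j)
      have h2 := Real.mul_self_sqrt (hpos j).le
      field_simp
      nlinarith
    have h2 : frobSq Y = (corr x).trace := by rw [hC, trace_mul_transpose_self]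
    have h3 : dataMatrix x - dataMatrix x * V * Vᵀ = √(m : ℝ) • (Y - Y * V * Vᵀ) := by
      rw [hXY, Matrix.smul_mul, Matrix.smul_mul, smul_sub]
    have h4 : frobSq (√(m : ℝ) • (Y - Y * V * Vᵀ)) = m * frobSq (Y - Y * V * Vᵀ) := by
      rw [frobSq_eq_sum, frobSq_eq_sum, Finset.mul_sum]
      refine Finset.sum_congr rfl fun i _ => ?_
      rw [Finset.mul_sum]
      refine Finset.sum_congr rfl fun j _ => ?_
      rw [Matrix.smul_apply, smul_eq_mul, mul_pow, Real.sq_sqrt (Nat.cast_nonneg m)]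
    rw [h3, h4, frobSq_sub_mul_isometry hVV, h1, h2, truncation_trace hk hU.orthogonal]
  -- The identity `VᵀΩH` factors through `XΩH`, which therefore has rank at least `k`.
  · have h1 : Vᵀ * Ω * H = D' * Ukᵀ * ((√(m : ℝ))⁻¹ • (dataMatrix x * Ω * H)) := by
      rw [hVT, hY]
      simp only [Matrix.mul_assoc, Matrix.mul_smul, Matrix.smul_mul]
    have h2 := Matrix.rank_mul_le_right (D' * Ukᵀ) ((√(m : ℝ))⁻¹ • (dataMatrix x * Ω * H))
    rw [← h1, h, Matrix.rank_one, Fintype.card_fin] at h2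
    refine h2.trans ?_
    have h3 : (√(m : ℝ))⁻¹ • (dataMatrix x * Ω * H)
        = dataMatrix x * Ω * H * ((√(m : ℝ))⁻¹ • (1 : Matrix (Fin k) (Fin k) ℝ)) := by
      rw [Matrix.mul_smul, Matrix.mul_one]
    rw [h3]
    exact Matrix.rank_mul_le_left _ _

end Spectral

/-! ### Regret of conditioned SGD -/

section StochasticGradient

variable {p n m : ℕ}

/-- Testing the subgradient inequality at `a + g a` gives `‖g a‖² ≤ f (a + g a) - f a ≤ ρ ‖g a‖`. -/
theorem IsSubgradientSelection.norm_le {f : EuclideanSpace ℝ (Fin p) → ℝ}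
    {g : EuclideanSpace ℝ (Fin p) → EuclideanSpace ℝ (Fin p)} (hg : IsSubgradientSelection f g)
    {ρ : ℝ≥0} (hf : LipschitzWith ρ f) (a : EuclideanSpace ℝ (Fin p)) : ‖g a‖ ≤ ρ := by
  have h1 := hg a (a + g a)
  have h2 := hf.dist_le_mul (a + g a) a
  rw [Real.dist_eq, dist_eq_norm, add_sub_cancel_left] at h2
  rw [add_sub_cancel_left, real_inner_self_eq_norm_sq] at h1
  have h3 := le_abs_self (f (a + g a) - f a)
  by_contra hc
  push Not at hc
  nlinarith [ρ.coe_nonneg]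

theorem empLoss_convex {x : Fin m → Fin n → ℝ} {ℓ : Fin m → EuclideanSpace ℝ (Fin p) → ℝ}
    (hconv : ∀ i, ConvexOn ℝ Set.univ (ℓ i)) {T : ℕ} (hT : 1 ≤ T)
    (W : ℕ → Matrix (Fin p) (Fin n) ℝ) :
    empLoss x ℓ ((T : ℝ)⁻¹ • ∑ t ∈ Finset.range T, W t)
      ≤ (T : ℝ)⁻¹ * ∑ t ∈ Finset.range T, empLoss x ℓ (W t) := by
  have hT' : (0 : ℝ) < T := by exact_mod_cast hT
  have h1 : ∀ i, predict ((T : ℝ)⁻¹ • ∑ t ∈ Finset.range T, W t) (x i)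
      = ∑ t ∈ Finset.range T, (T : ℝ)⁻¹ • predict (W t) (x i) := fun i => by
    unfold predict
    rw [Matrix.smul_mulVec, Matrix.sum_mulVec, WithLp.toLp_smul, WithLp.toLp_sum,
      Finset.smul_sum]
  have h2 : ∀ i, ℓ i (predict ((T : ℝ)⁻¹ • ∑ t ∈ Finset.range T, W t) (x i))
      ≤ ∑ t ∈ Finset.range T, (T : ℝ)⁻¹ * ℓ i (predict (W t) (x i)) := fun i => by
    rw [h1]
    refine (hconv i).map_sum_le (fun _ _ => by positivity) ?_ (fun _ _ => Set.mem_univ _)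
    rw [Finset.sum_const, Finset.card_range, nsmul_eq_mul, mul_inv_cancel₀ hT'.ne']
  unfold empLoss
  calc _ ≤ (m : ℝ)⁻¹ * ∑ i, ∑ t ∈ Finset.range T, (T : ℝ)⁻¹ * ℓ i (predict (W t) (x i)) := by
        gcongr with i; exact h2 i
    _ = _ := by
        rw [Finset.sum_comm]
        simp only [Finset.mul_sum]
        refine Finset.sum_congr rfl fun t _ => Finset.sum_congr rfl fun i _ => by ring

/-- The combinatorial form of independence from the future: the iterate used at time `t` does not
see the index drawn then. -/
theorem iterate_congr {T : ℕ} (x : Fin m → Fin n → ℝ)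
    (g : Fin m → EuclideanSpace ℝ (Fin p) → EuclideanSpace ℝ (Fin p)) (η : ℝ)
    (Ainv : Matrix (Fin n) (Fin n) ℝ) {i i' : Fin T → Fin m} {t : ℕ}
    (h : ∀ s : Fin T, (s : ℕ) < t → i s = i' s) :
    iterate x g η Ainv i t = iterate x g η Ainv i' t := by
  induction t with
  | zero => rfl
  | succ t ih =>
    have h1 := ih fun s hs => h s (hs.trans (Nat.lt_succ_self t))
    unfold iterate
    split_ifs with ht
    · rw [h1, h ⟨t, ht⟩ (Nat.lt_succ_self t)]
    · exact h1

/-- Averaging a function of the other indices and of a fresh index over the fresh index is the same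
as substituting the index sampled at time `t`. -/
theorem sum_average_eq_sum_sampled {T : ℕ} (hm : 0 < m) (Φ : (Fin T → Fin m) → Fin m → ℝ)
    (t : Fin T) (hΦ : ∀ i j, Φ (Function.update i t j) = Φ i) :
    ∑ i, (m : ℝ)⁻¹ * ∑ j, Φ i j = ∑ i, Φ i (i t) := by
  have hm' : (m : ℝ) ≠ 0 := by exact_mod_cast hm.ne'
  -- The involution that exchanges the index drawn at time `t` with the fresh one.
  let e : (Fin T → Fin m) × Fin m ≃ (Fin T → Fin m) × Fin m :=
    { toFun := fun q => (Function.update q.1 t q.2, q.1 t)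
      invFun := fun q => (Function.update q.1 t q.2, q.1 t)
      left_inv := fun q => by simp
      right_inv := fun q => by simp }
  have h1 := Equiv.sum_comp e (fun q => Φ q.1 (q.1 t))
  simp only [e, Equiv.coe_fn_mk, Function.update_self, hΦ] at h1
  rw [Fintype.sum_prod_type, Fintype.sum_prod_type] at h1
  simp only [Finset.sum_const, Finset.card_univ, Fintype.card_fin, nsmul_eq_mul] at h1
  rw [← Finset.mul_sum, h1, ← Finset.mul_sum, ← mul_assoc, inv_mul_cancel₀ hm', one_mul]

/-- The squared norm of `W` weighted by `A`. -/
def weightedSq (A : Matrix (Fin n) (Fin n) ℝ) (W : Matrix (Fin p) (Fin n) ℝ) : ℝ :=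
  (W * A * Wᵀ).trace

/-- In the `A`-norm the conditioner cancels from the cross term since `A v = x`, leaving the
ordinary gradient pairing; it survives only in the quadratic term `xᵀ v`. -/
theorem weightedSq_sub_vecMulVec {A : Matrix (Fin n) (Fin n) ℝ} (hA : Aᵀ = A)
    (W : Matrix (Fin p) (Fin n) ℝ) (a : Fin p → ℝ) {v x : Fin n → ℝ} (hv : A *ᵥ v = x) (η : ℝ) :
    weightedSq A (W - η • Matrix.vecMulVec a v)
      = weightedSq A W - 2 * η * (a ⬝ᵥ (W *ᵥ x)) + η ^ 2 * (a ⬝ᵥ a) * (x ⬝ᵥ v) := by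
  have hv' : v ᵥ* A = x := by rw [← Matrix.mulVec_transpose, hA, hv]
  have h1 : (Matrix.vecMulVec a v * A * Wᵀ).trace = a ⬝ᵥ (W *ᵥ x) := by
    rw [Matrix.vecMulVec_mul, hv', Matrix.vecMulVec_mul, Matrix.trace_vecMulVec,
      Matrix.vecMul_transpose]
  have h2 : (W * A * (Matrix.vecMulVec a v)ᵀ).trace = a ⬝ᵥ (W *ᵥ x) := by
    rw [← h1, ← Matrix.trace_transpose]
    simp only [Matrix.transpose_mul, Matrix.transpose_transpose, hA, Matrix.mul_assoc]
  have h3 : (Matrix.vecMulVec a v * A * (Matrix.vecMulVec a v)ᵀ).trace = (a ⬝ᵥ a) * (x ⬝ᵥ v) := by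
    rw [Matrix.vecMulVec_mul, hv', Matrix.transpose_vecMulVec, Matrix.vecMulVec_mul_vecMulVec,
      Matrix.trace_vecMulVec]
    simp [mul_comm]
  unfold weightedSq
  rw [Matrix.transpose_sub, Matrix.transpose_smul]
  simp only [Matrix.sub_mul, Matrix.mul_sub, Matrix.smul_mul, Matrix.mul_smul, Matrix.trace_sub,
    Matrix.trace_smul, h1, h2, h3, smul_eq_mul]
  ring

/-- The regret bound for conditioned SGD along one sequence of examples. -/
theorem regret_le {x : Fin m → Fin n → ℝ} {ℓ : Fin m → EuclideanSpace ℝ (Fin p) → ℝ}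
    {g : Fin m → EuclideanSpace ℝ (Fin p) → EuclideanSpace ℝ (Fin p)}
    (hg : ∀ i, IsSubgradientSelection (ℓ i) (g i)) {ρ : ℝ} (hρ : ∀ i a, ‖g i a‖ ≤ ρ)
    {A Ainv : Matrix (Fin n) (Fin n) ℝ} (hA : Aᵀ = A)
    (hA0 : ∀ W : Matrix (Fin p) (Fin n) ℝ, 0 ≤ weightedSq A W)
    (hx : ∀ i, A *ᵥ (Ainv *ᵥ x i) = x i) (hx0 : ∀ i, 0 ≤ x i ⬝ᵥ (Ainv *ᵥ x i)) {η : ℝ}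
    (hη : 0 ≤ η) {T : ℕ} (i : Fin T → Fin m) (Wstar : Matrix (Fin p) (Fin n) ℝ) :
    2 * η * ∑ t : Fin T, (ℓ (i t) (predict (iterate x g η Ainv i t) (x (i t)))
        - ℓ (i t) (predict Wstar (x (i t))))
      ≤ weightedSq A Wstar + η ^ 2 * ρ ^ 2 * ∑ t : Fin T, x (i t) ⬝ᵥ (Ainv *ᵥ x (i t)) := by
  set W := iterate x g η Ainv i with hW
  -- One update: the linear term of the expanded potential dominates the loss difference by the
  -- subgradient inequality, and the potentials then telescope.
  have step : ∀ t : Fin T, 2 * η * (ℓ (i t) (predict (W t) (x (i t)))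
        - ℓ (i t) (predict Wstar (x (i t))))
      ≤ weightedSq A (W t - Wstar) - weightedSq A (W (t + 1) - Wstar)
        + η ^ 2 * ρ ^ 2 * (x (i t) ⬝ᵥ (Ainv *ᵥ x (i t))) := by
    intro t
    set a := g (i t) (predict (W t) (x (i t))) with ha
    have h1 : W (t + 1) - Wstar
        = (W t - Wstar) - η • Matrix.vecMulVec a.ofLp (Ainv *ᵥ x (i t)) := by
      have : W (t + 1) = W t - η • Matrix.vecMulVec a.ofLp (Ainv *ᵥ x (i t)) := by
        rw [hW]
        conv_lhs => unfold iterate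
        rw [dif_pos t.2]
      rw [this]; abel
    have h2 := hg (i t) (predict (W t) (x (i t))) (predict Wstar (x (i t)))
    rw [← ha] at h2
    have h3 : inner ℝ a (predict Wstar (x (i t)) - predict (W t) (x (i t)))
        = - (a.ofLp ⬝ᵥ ((W t - Wstar) *ᵥ x (i t))) := by
      rw [Matrix.sub_mulVec, dotProduct_sub]
      simp [predict, PiLp.inner_apply, dotProduct, sub_mul, Finset.sum_sub_distrib, mul_comm]
    have h4 : a.ofLp ⬝ᵥ a.ofLp ≤ ρ ^ 2 := by
      have : a.ofLp ⬝ᵥ a.ofLp = ‖a‖ ^ 2 := by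
        rw [EuclideanSpace.real_norm_sq_eq]
        simp [dotProduct, pow_two]
      rw [this]
      exact pow_le_pow_left₀ (norm_nonneg _) (hρ _ _) 2
    rw [h1, weightedSq_sub_vecMulVec hA _ _ (hx (i t))]
    rw [h3] at h2
    have h5 := mul_le_mul_of_nonneg_left (mul_le_mul_of_nonneg_right h4 (hx0 (i t))) (sq_nonneg η)
    nlinarith
  rw [Finset.mul_sum]
  refine (Finset.sum_le_sum fun t _ => step t).trans ?_
  rw [Finset.sum_add_distrib, ← Finset.mul_sum]
  have h6 : ∑ t : Fin T, (weightedSq A (W t - Wstar) - weightedSq A (W (t + 1) - Wstar))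
      = weightedSq A (W 0 - Wstar) - weightedSq A (W T - Wstar) := by
    rw [Fin.sum_univ_eq_sum_range (fun t => weightedSq A (W t - Wstar)
      - weightedSq A (W (t + 1) - Wstar)), Finset.sum_range_sub']
  have h7 : weightedSq A (W 0 - Wstar) = weightedSq A Wstar := by
    have : W 0 = 0 := rfl
    rw [this, zero_sub]
    simp [weightedSq]
  rw [h6, h7]
  linarith [hA0 (W T - Wstar)]

end StochasticGradient

/-! ### The expected gap for a fixed conditioner -/

section ExpectedGap

variable {p n m k : ℕ}

theorem inv_corr_trace (x : Fin m → Fin n → ℝ) (M : Matrix (Fin n) (Fin n) ℝ) :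
    (m : ℝ)⁻¹ * ∑ j, x j ⬝ᵥ (M *ᵥ x j) = (M * corr x).trace := by
  unfold corr
  rw [Matrix.mul_smul, Matrix.trace_smul, smul_eq_mul, Matrix.mul_sum, Matrix.trace_sum]
  congr 1
  refine Finset.sum_congr rfl fun j _ => ?_
  rw [Matrix.mul_vecMulVec, Matrix.trace_vecMulVec, dotProduct_comm]

/-- Jensen over time, followed by the regret bound averaged over all index sequences. Only `A A⁻¹
x_i = x_i` on the data is required, which allows a singular `A` when the residual off the sketch
vanishes. -/
theorem expectedGap_le_of_conditioner (hm : 0 < m) {x : Fin m → Fin n → ℝ}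
    {ℓ : Fin m → EuclideanSpace ℝ (Fin p) → ℝ}
    {g : Fin m → EuclideanSpace ℝ (Fin p) → EuclideanSpace ℝ (Fin p)}
    (hconv : ∀ i, ConvexOn ℝ Set.univ (ℓ i))
    (hg : ∀ i, IsSubgradientSelection (ℓ i) (g i)) {ρ : ℝ} (hρ : ∀ i a, ‖g i a‖ ≤ ρ)
    {A Ainv : Matrix (Fin n) (Fin n) ℝ} (hA : Aᵀ = A)
    (hA0 : ∀ W : Matrix (Fin p) (Fin n) ℝ, 0 ≤ weightedSq A W)
    (hx : ∀ i, A *ᵥ (Ainv *ᵥ x i) = x i) (hx0 : ∀ i, 0 ≤ x i ⬝ᵥ (Ainv *ᵥ x i)) {η : ℝ}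
    (hη : 0 < η) {T : ℕ} (hT : 1 ≤ T) (Wstar : Matrix (Fin p) (Fin n) ℝ) :
    expectedGap x ℓ g η T Ainv Wstar
      ≤ weightedSq A Wstar / (2 * η * T) + η * ρ ^ 2 / 2 * (Ainv * corr x).trace := by
  have hT' : (0 : ℝ) < T := by exact_mod_cast hT
  have hm' : (0 : ℝ) < m := by exact_mod_cast hm
  have hmT : (0 : ℝ) < (m : ℝ) ^ T := by positivity
  set W : (Fin T → Fin m) → ℕ → Matrix (Fin p) (Fin n) ℝ := iterate x g η Ainv with hW
  set q : ℝ := (Ainv * corr x).trace with hq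
  have hupd : ∀ (t : Fin T) i j, W (Function.update i t j) t = W i t := fun t i j =>
    iterate_congr x g η Ainv fun s hs => by
      rw [Function.update_of_ne]
      intro h
      rw [h] at hs
      exact lt_irrefl _ hs
  have h1 : ∀ i, empLoss x ℓ (averaged x g η Ainv i) - empLoss x ℓ Wstar
      ≤ (T : ℝ)⁻¹ * ∑ t : Fin T, (empLoss x ℓ (W i t) - empLoss x ℓ Wstar) := fun i => by
    have := empLoss_convex (x := x) hconv hT (W i)
    rw [Finset.sum_sub_distrib, Finset.sum_const, Finset.card_univ, Fintype.card_fin,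
      nsmul_eq_mul, mul_sub, inv_mul_cancel_left₀ hT'.ne',
      Fin.sum_univ_eq_sum_range (fun t => empLoss x ℓ (W i t))]
    exact sub_le_sub_right this _
  -- The loss over all examples can be replaced by the sampled loss, because `hupd` makes the
  -- iterate blind to the index being averaged.
  have h2 : ∑ i, ∑ t : Fin T, (empLoss x ℓ (W i t) - empLoss x ℓ Wstar)
      = ∑ i : Fin T → Fin m, ∑ t : Fin T, (ℓ (i t) (predict (W i t) (x (i t)))
        - ℓ (i t) (predict Wstar (x (i t)))) := by
    rw [Finset.sum_comm, Finset.sum_comm (s := Finset.univ (α := Fin T → Fin m))]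
    refine Finset.sum_congr rfl fun t _ => ?_
    rw [← sum_average_eq_sum_sampled hm (fun i j => ℓ j (predict (W i t) (x j))
      - ℓ j (predict Wstar (x j))) t (fun i j => by rw [hupd])]
    refine Finset.sum_congr rfl fun i _ => ?_
    rw [Finset.sum_sub_distrib, mul_sub]
    rfl
  have h3 : ∑ i : Fin T → Fin m, ∑ t : Fin T, x (i t) ⬝ᵥ (Ainv *ᵥ x (i t))
      = (m : ℝ) ^ T * (T * q) := by
    rw [Finset.sum_comm]
    have : ∀ t : Fin T, ∑ i : Fin T → Fin m, x (i t) ⬝ᵥ (Ainv *ᵥ x (i t)) = (m : ℝ) ^ T * q := by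
      intro t
      rw [← sum_average_eq_sum_sampled hm (fun _ j => x j ⬝ᵥ (Ainv *ᵥ x j)) t (fun _ _ => rfl)]
      rw [Finset.sum_const, inv_corr_trace, Finset.card_univ, Fintype.card_fun, Fintype.card_fin,
        Fintype.card_fin, nsmul_eq_mul]
      push_cast
      rfl
    simp only [this, Finset.sum_const, Finset.card_univ, Fintype.card_fin, nsmul_eq_mul]
    ring
  have h4 := Finset.sum_le_sum fun (i : Fin T → Fin m) (_ : i ∈ Finset.univ) =>
    regret_le (ℓ := ℓ) hg hρ hA hA0 hx hx0 hη.le i Wstar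
  rw [← Finset.mul_sum, Finset.sum_add_distrib, ← Finset.mul_sum, h3, Finset.sum_const,
    Finset.card_univ, Fintype.card_fun, Fintype.card_fin, Fintype.card_fin, nsmul_eq_mul] at h4
  push_cast at h4
  rw [← h2] at h4
  have h5 := Finset.sum_le_sum fun (i : Fin T → Fin m) (_ : i ∈ Finset.univ) => h1 i
  rw [← Finset.mul_sum] at h5
  unfold expectedGap
  set R := ∑ i, ∑ t : Fin T, (empLoss x ℓ (W i t) - empLoss x ℓ Wstar) with hR
  calc _ ≤ ((m : ℝ) ^ T)⁻¹ * ((T : ℝ)⁻¹ * R) := by gcongr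
    _ = ((m : ℝ) ^ T)⁻¹ * ((T : ℝ)⁻¹ * ((2 * η)⁻¹ * (2 * η * R))) := by field_simp
    _ ≤ ((m : ℝ) ^ T)⁻¹ * ((T : ℝ)⁻¹ * ((2 * η)⁻¹ * ((m : ℝ) ^ T * weightedSq A Wstar
          + η ^ 2 * ρ ^ 2 * ((m : ℝ) ^ T * (T * q))))) := by gcongr
    _ = _ := by field_simp

/-- The two summands act on the range of `Q` and on its orthogonal complement. Nothing need be
invertible, so the case `a = 0` is covered. -/
theorem conditioner_mul {Q : Matrix (Fin n) (Fin k) ℝ} (hQ : Qᵀ * Q = 1)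
    (B B' : Matrix (Fin k) (Fin k) ℝ) (a a' : ℝ) :
    conditioner Q B a * conditioner Q B' a' = conditioner Q (B * B') (a * a') := by
  have h1 : ∀ M : Matrix (Fin k) (Fin n) ℝ, Qᵀ * (Q * M) = M := fun M => by
    rw [← Matrix.mul_assoc, hQ, Matrix.one_mul]
  unfold conditioner
  simp only [Matrix.add_mul, Matrix.mul_add, Matrix.mul_smul, Matrix.smul_mul, Matrix.mul_sub,
    Matrix.sub_mul, Matrix.mul_one, Matrix.one_mul, Matrix.mul_assoc, h1, sub_self,
    smul_zero, add_zero]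
  rw [add_sub_cancel_left, smul_smul, mul_comm a' a]

theorem frobSq_smul {ι κ : Type*} [Fintype ι] [Fintype κ] (a : ℝ) (M : Matrix ι κ ℝ) :
    frobSq (a • M) = a ^ 2 * frobSq M := by
  simp [frobSq, Matrix.trace_smul, smul_smul, pow_two]

/-- Gram matrices turn the weighted norm into Frobenius norms, which give both its positivity and
its bound by the spectral norm of `W⋆`. -/
theorem conditioner_diagonal_eq {Q : Matrix (Fin n) (Fin k) ℝ} (hQ : Qᵀ * Q = 1) {b : Fin k → ℝ}
    (hb : ∀ j, 0 ≤ b j) (a : ℝ) :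
    conditioner Q (Matrix.diagonal b) a
      = (Q * Matrix.diagonal fun j => √(b j)) * (Q * Matrix.diagonal fun j => √(b j))ᵀ
        + a • ((1 - Q * Qᵀ) * (1 - Q * Qᵀ)ᵀ) := by
  have h1 : Matrix.diagonal b
      = (Matrix.diagonal fun j => √(b j)) * (Matrix.diagonal fun j => √(b j)) := by
    rw [Matrix.diagonal_mul_diagonal]
    congr 1; ext j; exact (Real.mul_self_sqrt (hb j)).symm
  have h2 : (1 - Q * Qᵀ) * (1 - Q * Qᵀ)ᵀ = 1 - Q * Qᵀ := by
    have h3 : Qᵀ * (Q * Qᵀ) = Qᵀ := by rw [← Matrix.mul_assoc, hQ, Matrix.one_mul]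
    simp [Matrix.sub_mul, Matrix.mul_sub, Matrix.mul_assoc, h3]
  unfold conditioner
  rw [h2, h1]
  simp only [Matrix.transpose_mul, Matrix.diagonal_transpose, Matrix.mul_assoc]

theorem weightedSq_conditioner {Q : Matrix (Fin n) (Fin k) ℝ} (hQ : Qᵀ * Q = 1) {b : Fin k → ℝ}
    (hb : ∀ j, 0 ≤ b j) (a : ℝ) (W : Matrix (Fin p) (Fin n) ℝ) :
    weightedSq (conditioner Q (Matrix.diagonal b) a) W
      = frobSq (W * (Q * Matrix.diagonal fun j => √(b j))) + a * frobSq (W * (1 - Q * Qᵀ)) := by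
  rw [conditioner_diagonal_eq hQ hb, weightedSq, ← trace_mul_transpose_self,
    ← trace_mul_transpose_self, ← smul_eq_mul a, ← Matrix.trace_smul, ← Matrix.trace_add]
  congr 1
  rw [Matrix.mul_add, Matrix.add_mul, Matrix.mul_smul, Matrix.smul_mul, Matrix.transpose_mul W,
    Matrix.transpose_mul W]
  simp only [Matrix.mul_assoc]

theorem weightedSq_conditioner_nonneg {Q : Matrix (Fin n) (Fin k) ℝ} (hQ : Qᵀ * Q = 1)
    {b : Fin k → ℝ} (hb : ∀ j, 0 ≤ b j) {a : ℝ} (ha : 0 ≤ a) (W : Matrix (Fin p) (Fin n) ℝ) :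
    0 ≤ weightedSq (conditioner Q (Matrix.diagonal b) a) W := by
  rw [weightedSq_conditioner hQ hb]
  exact add_nonneg (frobSq_nonneg _) (mul_nonneg ha (frobSq_nonneg _))

theorem dotProduct_conditioner_nonneg {Q : Matrix (Fin n) (Fin k) ℝ} (hQ : Qᵀ * Q = 1)
    {b : Fin k → ℝ} (hb : ∀ j, 0 ≤ b j) {a : ℝ} (ha : 0 ≤ a) (v : Fin n → ℝ) :
    0 ≤ v ⬝ᵥ (conditioner Q (Matrix.diagonal b) a *ᵥ v) := by
  have h := weightedSq_conditioner_nonneg (p := 1) hQ hb ha (Matrix.of fun _ => v)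
  have h1 : weightedSq (conditioner Q (Matrix.diagonal b) a)
      (Matrix.of fun _ : Fin 1 => v) = v ⬝ᵥ (conditioner Q (Matrix.diagonal b) a *ᵥ v) := by
    rw [weightedSq, Matrix.mul_assoc]
    simp [Matrix.trace, Matrix.mul_apply, dotProduct, Matrix.mulVec]
  rwa [h1] at h

theorem mulVec_norm_le_specNorm (W : Matrix (Fin p) (Fin n) ℝ) (v : Fin n → ℝ) :
    (W *ᵥ v) ⬝ᵥ (W *ᵥ v) ≤ specNorm W ^ 2 * (v ⬝ᵥ v) := by
  have h := (Matrix.toEuclideanLin W).toContinuousLinearMap.le_opNorm (WithLp.toLp 2 v)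
  have h1 := pow_le_pow_left₀ (norm_nonneg _) h 2
  rw [mul_pow, EuclideanSpace.real_norm_sq_eq, EuclideanSpace.real_norm_sq_eq] at h1
  simpa [dotProduct, pow_two, specNorm] using h1

theorem frobSq_mul_le_specNorm {κ : Type*} [Fintype κ] (W : Matrix (Fin p) (Fin n) ℝ)
    (N : Matrix (Fin n) κ ℝ) : frobSq (W * N) ≤ specNorm W ^ 2 * frobSq N := by
  rw [frobSq_eq_sum_col, frobSq_eq_sum_col, Finset.mul_sum]
  exact Finset.sum_le_sum fun j _ => mulVec_norm_le_specNorm W (N.col j)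

theorem specNorm_nonneg (W : Matrix (Fin p) (Fin n) ℝ) : 0 ≤ specNorm W := norm_nonneg _

theorem eq_zero_of_specNorm_eq_zero {W : Matrix (Fin p) (Fin n) ℝ} (h : specNorm W = 0) :
    W = 0 := by
  refine frobSq_eq_zero (le_antisymm ?_ (frobSq_nonneg _))
  have := frobSq_mul_le_specNorm W (1 : Matrix (Fin n) (Fin n) ℝ)
  rwa [Matrix.mul_one, h, zero_pow two_ne_zero, zero_mul] at this

theorem frobSq_sub_projection {Q : Matrix (Fin n) (Fin k) ℝ} (hQ : Qᵀ * Q = 1)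
    (X : Matrix (Fin n) (Fin m) ℝ) :
    frobSq (X - Q * Qᵀ * X) = frobSq X - (Qᵀ * (X * Xᵀ) * Q).trace := by
  have h := frobSq_sub_mul_isometry hQ Xᵀ
  have h1 : Xᵀ - Xᵀ * Q * Qᵀ = (X - Q * Qᵀ * X)ᵀ := by
    simp [Matrix.transpose_sub, Matrix.transpose_mul, Matrix.mul_assoc]
  rw [h1, frobSq_transpose, frobSq_transpose] at h
  rw [h]
  congr 1
  rw [frobSq, Matrix.transpose_mul, Matrix.transpose_transpose]
  simp only [Matrix.mul_assoc]

theorem corr_trace (x : Fin m → Fin n → ℝ) :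
    (corr x).trace = (m : ℝ)⁻¹ * frobSq (dataMatrix x) := by
  rw [corr_eq, Matrix.trace_smul, trace_mul_transpose_self, smul_eq_mul]

/-- This shows that `tr C - tr C̃` is nonnegative, and that its vanishing puts every instance in the
range of `Q`. -/
theorem frobSq_sub_projection_dataMatrix (hm : 0 < m) {Q : Matrix (Fin n) (Fin k) ℝ}
    (hQ : Qᵀ * Q = 1) (x : Fin m → Fin n → ℝ) :
    frobSq (dataMatrix x - Q * Qᵀ * dataMatrix x)
      = m * ((corr x).trace - (compressed (corr x) Q).trace) := by
  have hm' : (m : ℝ) ≠ 0 := by exact_mod_cast hm.ne'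
  rw [frobSq_sub_projection hQ, compressed, corr_trace, corr_eq, Matrix.mul_smul, Matrix.smul_mul,
    Matrix.trace_smul, smul_eq_mul]
  field_simp

theorem sketchedInv_eq {C : Matrix (Fin n) (Fin n) ℝ} {Q : Matrix (Fin n) (Fin k) ℝ}
    {μ : Fin k → ℝ} (hμ : ∀ j, 0 < μ j) (h : compressed C Q = Matrix.diagonal μ) :
    sketchedInv C Q = conditioner Q (Matrix.diagonal fun j => (√(μ j))⁻¹)
      (√(((n : ℝ) - k) / (C.trace - ∑ j, μ j))) := by
  have h1 : psdSqrt (Matrix.diagonal μ) = Matrix.diagonal fun j => √(μ j) := by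
    rw [psdSqrt_eq (V := 1) (d := μ) (by simp) (by simp)]
    simp
  have h2 : (Matrix.diagonal fun j => √(μ j))⁻¹ = Matrix.diagonal fun j => (√(μ j))⁻¹ := by
    refine Matrix.inv_eq_right_inv ?_
    rw [Matrix.diagonal_mul_diagonal, ← Matrix.diagonal_one]
    congr 1; ext j
    exact mul_inv_cancel₀ (Real.sqrt_pos.2 (hμ j)).ne'
  rw [sketchedInv, h, h1, h2, Matrix.trace_diagonal]

/-- The guarantee of conditioned SGD with the conditioner built from an orthonormal `Q`. -/
theorem expectedGap_le (hm : 0 < m) (hkn : k < n) {x : Fin m → Fin n → ℝ}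
    {ℓ : Fin m → EuclideanSpace ℝ (Fin p) → ℝ}
    {g : Fin m → EuclideanSpace ℝ (Fin p) → EuclideanSpace ℝ (Fin p)}
    (hconv : ∀ i, ConvexOn ℝ Set.univ (ℓ i))
    (hg : ∀ i, IsSubgradientSelection (ℓ i) (g i)) {ρ : ℝ} (hρ0 : 0 < ρ)
    (hρ : ∀ i a, ‖g i a‖ ≤ ρ) {T : ℕ} (hT : 1 ≤ T) {Wstar : Matrix (Fin p) (Fin n) ℝ} {σ : ℝ}
    (hσ : specNorm Wstar ≤ σ) {Q : Matrix (Fin n) (Fin k) ℝ} (hQ : Qᵀ * Q = 1) {μ : Fin k → ℝ}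
    (hμ : ∀ j, 0 < μ j) (hC : compressed (corr x) Q = Matrix.diagonal μ) :
    expectedGap x ℓ g (σ / (ρ * √T)) T (sketchedInv (corr x) Q) Wstar
      ≤ σ * ρ / √T * (∑ j, √(μ j) + √(((n : ℝ) - k) * ((corr x).trace - ∑ j, μ j))) := by
  have hσ0 : 0 ≤ σ := (specNorm_nonneg _).trans hσ
  have hT' : (0 : ℝ) < T := by exact_mod_cast hT
  have hsT : 0 < √(T : ℝ) := Real.sqrt_pos.2 hT'
  have hm' : (0 : ℝ) < m := by exact_mod_cast hm
  -- For `σ = 0` the step size is zero and the regret bound cannot be divided by it; but then `W⋆ =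
  -- 0` and the iterates stay at `0`.
  rcases hσ0.eq_or_lt with h0 | hσpos
  · have hW : Wstar = 0 :=
      eq_zero_of_specNorm_eq_zero (le_antisymm (hσ.trans_eq h0.symm) (specNorm_nonneg _))
    have hit : ∀ i t, iterate x g 0 (sketchedInv (corr x) Q) (T := T) i t = 0 := by
      intro i t
      induction t with
      | zero => rfl
      | succ t ih =>
        unfold iterate
        split_ifs
        · rw [ih, zero_smul, sub_zero]
        · exact ih
    rw [← h0, hW]
    simp [expectedGap, averaged, hit]
  set Δ := (corr x).trace - ∑ j, μ j with hΔ
  set s := ∑ j, √(μ j) with hs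
  have hnk : (0 : ℝ) < (n : ℝ) - k := sub_pos.2 (by exact_mod_cast hkn)
  have hfrob : frobSq (dataMatrix x - Q * Qᵀ * dataMatrix x) = m * Δ := by
    rw [frobSq_sub_projection_dataMatrix hm hQ, hC, Matrix.trace_diagonal]
  have hΔ0 : 0 ≤ Δ := by
    have := frobSq_nonneg (dataMatrix x - Q * Qᵀ * dataMatrix x)
    rw [hfrob] at this
    exact nonneg_of_mul_nonneg_right this hm'
  set a := √(Δ / ((n : ℝ) - k)) with ha
  set a' := √(((n : ℝ) - k) / Δ) with ha'
  set A := conditioner Q (Matrix.diagonal fun j => √(μ j)) a with hA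
  set τ := √(((n : ℝ) - k) * Δ) with hτ
  have hb : ∀ j, 0 ≤ √(μ j) := fun j => Real.sqrt_nonneg _
  have hb' : ∀ j, 0 ≤ (√(μ j))⁻¹ := fun j => inv_nonneg.2 (hb j)
  -- The choice of `a` equalises the two contributions of the complement: `a (n - k)` in the trace
  -- of `A`, and `a' Δ` in the trace of `A⁻¹ C`. For `Δ = 0` all of `a`, `a'` and `τ` are zero.
  have haτ : a * ((n : ℝ) - k) = τ := by
    rw [ha, hτ, ← Real.sqrt_sq hnk.le, ← Real.sqrt_mul (by positivity), Real.sqrt_sq hnk.le]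
    congr 1; field_simp
  have haτ' : a' * Δ = τ := by
    rcases hΔ0.eq_or_lt with h | h
    · rw [hτ, ← h]; simp
    · rw [ha', hτ]
      nth_rw 2 [← Real.sqrt_sq h.le]
      rw [← Real.sqrt_mul (by positivity)]
      congr 1; field_simp
  rw [sketchedInv_eq hμ hC]
  have hAt : Aᵀ = A := by
    rw [hA, conditioner]
    simp [Matrix.transpose_mul, Matrix.mul_assoc]
  have hdiag : (Matrix.diagonal fun j => √(μ j)) * (Matrix.diagonal fun j => (√(μ j))⁻¹) = 1 := by
    rw [Matrix.diagonal_mul_diagonal, ← Matrix.diagonal_one]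
    congr 1; ext j
    exact mul_inv_cancel₀ (Real.sqrt_pos.2 (hμ j)).ne'
  have hx : ∀ i, A *ᵥ (conditioner Q (Matrix.diagonal fun j => (√(μ j))⁻¹) a' *ᵥ x i) = x i := by
    intro i
    rw [Matrix.mulVec_mulVec, hA, conditioner_mul hQ, hdiag]
    rcases hΔ0.eq_or_lt with h | h
    · have h1 : a = 0 := by rw [ha, ← h]; simp
      have h2 : dataMatrix x - Q * Qᵀ * dataMatrix x = 0 :=
        frobSq_eq_zero (by rw [hfrob, ← h, mul_zero])
      rw [h1, zero_mul, conditioner, zero_smul, add_zero, Matrix.mul_one]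
      ext b
      have h3 := congrFun (congrFun (sub_eq_zero.1 h2) b) i
      rw [Matrix.mul_apply] at h3
      exact h3.symm
    · have h1 : a * a' = 1 := by
        rw [ha, ha', ← Real.sqrt_mul (by positivity)]
        rw [show Δ / ((n : ℝ) - k) * (((n : ℝ) - k) / Δ) = 1 by field_simp, Real.sqrt_one]
      rw [h1, conditioner, one_smul, Matrix.mul_one, add_sub_cancel, Matrix.one_mulVec]
  have key := expectedGap_le_of_conditioner hm hconv hg hρ hAt
    (fun W => weightedSq_conditioner_nonneg hQ hb (Real.sqrt_nonneg _) W) hx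
    (fun i => dotProduct_conditioner_nonneg hQ hb' (Real.sqrt_nonneg _) (x i))
    (η := σ / (ρ * √T)) (by positivity) hT Wstar
  refine key.trans ?_
  have hw : weightedSq A Wstar ≤ σ ^ 2 * (s + τ) := by
    rw [hA, weightedSq_conditioner hQ hb]
    have h1 := frobSq_mul_le_specNorm Wstar (Q * Matrix.diagonal fun j => √(√(μ j)))
    have h2 := frobSq_mul_le_specNorm Wstar (1 - Q * Qᵀ)
    have h3 : frobSq (Q * Matrix.diagonal fun j => √(√(μ j))) = s := by
      rw [frobSq_of_isometry_mul hQ, frobSq, Matrix.diagonal_transpose,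
        Matrix.diagonal_mul_diagonal, Matrix.trace_diagonal]
      exact Finset.sum_congr rfl fun j _ => Real.mul_self_sqrt (hb j)
    have h4 : frobSq (1 - Q * Qᵀ) = (n : ℝ) - k := by
      have := frobSq_sub_mul_isometry hQ (1 : Matrix (Fin n) (Fin n) ℝ)
      rw [Matrix.one_mul, frobSq_of_isometry hQ,
        frobSq_of_isometry (N := (1 : Matrix (Fin n) (Fin n) ℝ)) (by simp), Fintype.card_fin,
        Fintype.card_fin] at this
      exact this
    rw [h3] at h1
    rw [h4] at h2
    have h5 : specNorm Wstar ^ 2 ≤ σ ^ 2 := pow_le_pow_left₀ (specNorm_nonneg _) hσ 2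
    have h6 : 0 ≤ s := Finset.sum_nonneg fun j _ => hb j
    calc _ ≤ specNorm Wstar ^ 2 * s + a * (specNorm Wstar ^ 2 * ((n : ℝ) - k)) :=
          add_le_add h1 (mul_le_mul_of_nonneg_left h2 (Real.sqrt_nonneg _))
      _ = specNorm Wstar ^ 2 * (s + τ) := by rw [← haτ]; ring
      _ ≤ _ := mul_le_mul_of_nonneg_right h5 (add_nonneg h6 (Real.sqrt_nonneg _))
  have htr : (conditioner Q (Matrix.diagonal fun j => (√(μ j))⁻¹) a' * corr x).trace = s + τ := by
    rw [conditioner, Matrix.add_mul, Matrix.trace_add, Matrix.smul_mul, Matrix.trace_smul,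
      Matrix.sub_mul, Matrix.one_mul, Matrix.trace_sub]
    have h1 : (Q * Qᵀ * corr x).trace = ∑ j, μ j := by
      rw [Matrix.mul_assoc, Matrix.trace_mul_comm, ← Matrix.trace_diagonal μ, ← hC, compressed]
    have h2 : (Q * (Matrix.diagonal fun j => (√(μ j))⁻¹) * Qᵀ * corr x).trace = s := by
      rw [Matrix.mul_assoc, Matrix.mul_assoc, Matrix.trace_mul_comm, Matrix.mul_assoc, ← compressed,
        hC, Matrix.diagonal_mul_diagonal, Matrix.trace_diagonal]
      refine Finset.sum_congr rfl fun j _ => ?_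
      rw [inv_mul_eq_div, Real.div_sqrt]
    rw [h1, h2, smul_eq_mul, haτ']
  rw [htr]
  have hTT := Real.mul_self_sqrt hT'.le
  -- With this `η` each summand equals `σρ(s + τ)/(2√T)`.
  calc _ ≤ σ ^ 2 * (s + τ) / (2 * (σ / (ρ * √T)) * T)
        + σ / (ρ * √T) * ρ ^ 2 / 2 * (s + τ) := by gcongr
    _ = _ := by
        nth_rw 2 [← hTT]
        field_simp
        ring

end ExpectedGap

/-! ### Invariance and second moments of Gaussian matrices -/

section Gaussian

open scoped ENNReal

/-- The law of a vector with i.i.d. centered Gaussian entries of variance `v`. -/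
noncomputable abbrev gaussVec (κ : Type*) [Fintype κ] (v : ℝ≥0) : Measure (κ → ℝ) :=
  Measure.pi fun _ => gaussianReal 0 v

/-- The law of a matrix with i.i.d. centered Gaussian entries of variance `v`. -/
noncomputable abbrev gaussMat (ι κ : Type*) [Fintype ι] [Fintype κ] (v : ℝ≥0) :
    Measure (ι → κ → ℝ) :=
  Measure.pi fun _ => gaussVec κ v

variable {ι κ κ' : Type*} [Fintype ι] [Fintype κ] [Fintype κ'] [DecidableEq ι] [DecidableEq κ]
  [DecidableEq κ'] {v : ℝ≥0}

theorem charFunDual_gaussVec (L : StrongDual ℝ (κ → ℝ)) :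
    charFunDual (gaussVec κ v) L
      = Complex.exp (-((v * ∑ i, L (Pi.single i 1) ^ 2 / 2 : ℝ) : ℂ)) := by
  rw [charFunDual_pi]
  have h : ∀ i, charFunDual (gaussianReal 0 v)
      (L.comp (ContinuousLinearMap.single ℝ (fun _ : κ => ℝ) i))
      = Complex.exp (-((v * (L (Pi.single i 1) ^ 2 / 2) : ℝ) : ℂ)) := fun i => by
    have h1 : L.comp (ContinuousLinearMap.single ℝ (fun _ : κ => ℝ) i)
        = L (Pi.single i 1) • (ContinuousLinearMap.id ℝ ℝ) := by
      ext; simp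
    rw [h1, ← charFun_map_eq_charFunDual_smul]
    have h2 : (gaussianReal 0 v).map (ContinuousLinearMap.id ℝ ℝ) = gaussianReal 0 v :=
      Measure.map_id
    rw [h2, charFun_gaussianReal]
    congr 1
    push_cast
    ring
  simp only [h]
  rw [← Complex.exp_sum, Finset.sum_neg_distrib, ← Complex.ofReal_sum, ← Finset.mul_sum]

/-- The matrix of coefficients of a linear form on matrices. -/
def coeffMat (L : StrongDual ℝ (ι → κ → ℝ)) : Matrix ι κ ℝ :=
  Matrix.of fun i l => L (Pi.single i (Pi.single l 1))

theorem apply_eq_sum_coeffMat (L : StrongDual ℝ (ι → κ → ℝ)) (Z : ι → κ → ℝ) :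
    L Z = ∑ i, ∑ l, coeffMat L i l * Z i l := by
  have h : Z = ∑ i, ∑ l, Z i l • (Pi.single i (Pi.single l 1) : ι → κ → ℝ) := by
    ext a b
    simp only [Finset.sum_apply, Pi.smul_apply, smul_eq_mul]
    rw [Finset.sum_eq_single a, Finset.sum_eq_single b]
    · simp
    · intro l _ hl; simp [hl.symm]
    · simp
    · intro i _ hi; simp [hi.symm]
    · simp
  conv_lhs => rw [h]
  simp only [map_sum, map_smul, smul_eq_mul, coeffMat, Matrix.of_apply]
  exact Finset.sum_congr rfl fun i _ => Finset.sum_congr rfl fun l _ => mul_comm _ _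

theorem coeffMat_eq_of_apply {L : StrongDual ℝ (ι → κ → ℝ)} {M : Matrix ι κ ℝ}
    (h : ∀ Z, L Z = ∑ i, ∑ l, M i l * Z i l) : coeffMat L = M := by
  ext a b
  rw [coeffMat, Matrix.of_apply, h, Finset.sum_eq_single a, Finset.sum_eq_single b]
  · simp
  · intro l _ hl; simp [hl]
  · simp
  · intro i _ hi; simp [hi]
  · simp

/-- Only the Frobenius norm of the coefficients enters, so identities between Gaussian laws reduce
to identities between Frobenius norms. -/
theorem charFunDual_gaussMat (L : StrongDual ℝ (ι → κ → ℝ)) :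
    charFunDual (gaussMat ι κ v) L
      = Complex.exp (-((v * (frobSq (coeffMat L) / 2) : ℝ) : ℂ)) := by
  rw [charFunDual_pi]
  simp only [charFunDual_gaussVec]
  rw [← Complex.exp_sum, Finset.sum_neg_distrib, ← Complex.ofReal_sum, ← Finset.mul_sum,
    frobSq_eq_sum, Finset.sum_div]
  congr 5
  ext i
  rw [Finset.sum_div]
  rfl

/-- A coisometry maps a Gaussian vector to a Gaussian vector. -/
theorem gaussVec_map_of_coisometry {E : Matrix ι κ ℝ} (hE : E * Eᵀ = 1) :
    (gaussVec κ v).map (fun y => E *ᵥ y) = gaussVec ι v := by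
  let T : (κ → ℝ) →L[ℝ] (ι → ℝ) := LinearMap.toContinuousLinearMap E.mulVecLin
  have hT : (fun y => E *ᵥ y) = T := rfl
  have : IsProbabilityMeasure ((gaussVec κ v).map T) :=
    Measure.isProbabilityMeasure_map (by fun_prop)
  rw [hT]
  refine Measure.ext_of_charFunDual ?_
  ext L
  rw [charFunDual_map, charFunDual_gaussVec, charFunDual_gaussVec]
  congr 5
  set ℓ : ι → ℝ := fun i => L (Pi.single i 1) with hℓ
  have h1 : ∀ y, L y = ℓ ⬝ᵥ y := fun y => by
    conv_lhs => rw [pi_eq_sum_univ' y]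
    simp [map_sum, dotProduct, hℓ, mul_comm]
  have h2 : ∀ j, (L.comp T) (Pi.single j 1) = (Eᵀ *ᵥ ℓ) j := fun j => by
    have : T (Pi.single j 1) = E *ᵥ (Pi.single j 1) := rfl
    rw [ContinuousLinearMap.comp_apply, this, h1, Matrix.mulVec_transpose,
      Matrix.dotProduct_mulVec]
    simp
  have h3 : (Eᵀ *ᵥ ℓ) ⬝ᵥ (Eᵀ *ᵥ ℓ) = ℓ ⬝ᵥ ℓ := by
    rw [Matrix.dotProduct_mulVec, Matrix.vecMul_transpose, Matrix.mulVec_mulVec, hE,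
      Matrix.one_mulVec]
  simp only [h2, ← Finset.sum_div]
  congr 1
  simpa [dotProduct, pow_two] using h3

/-- A Gaussian matrix `Ω` is distributed as `V G + (1 - V Vᵀ) Z` with independent Gaussian
matrices `G` and `Z`. -/
theorem gaussMat_map_add {m k r : ℕ} {V : Matrix (Fin m) (Fin k) ℝ} (hV : Vᵀ * V = 1) :
    ((gaussMat (Fin k) (Fin r) v).prod (gaussMat (Fin m) (Fin r) v)).map
      (fun q i j =>
        (V * Matrix.of q.1 + (1 - V * Vᵀ) * Matrix.of q.2 : Matrix (Fin m) (Fin r) ℝ) i j)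
      = gaussMat (Fin m) (Fin r) v := by
  let T₁ : (Fin k → Fin r → ℝ) →ₗ[ℝ] (Fin m → Fin r → ℝ) :=
    { toFun := fun G => V * Matrix.of G
      map_add' := fun a b => by exact Matrix.mul_add V (Matrix.of a) (Matrix.of b)
      map_smul' := fun c a => by exact Matrix.mul_smul V c (Matrix.of a) }
  let T₂ : (Fin m → Fin r → ℝ) →ₗ[ℝ] (Fin m → Fin r → ℝ) :=
    { toFun := fun G => (1 - V * Vᵀ) * Matrix.of G
      map_add' := fun a b => by exact Matrix.mul_add (1 - V * Vᵀ) (Matrix.of a) (Matrix.of b)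
      map_smul' := fun c a => by exact Matrix.mul_smul (1 - V * Vᵀ) c (Matrix.of a) }
  let T : ((Fin k → Fin r → ℝ) × (Fin m → Fin r → ℝ)) →L[ℝ] (Fin m → Fin r → ℝ) :=
    LinearMap.toContinuousLinearMap (T₁.coprod T₂)
  have hT : (fun (q : (Fin k → Fin r → ℝ) × (Fin m → Fin r → ℝ)) i j =>
      (V * Matrix.of q.1 + (1 - V * Vᵀ) * Matrix.of q.2 : Matrix (Fin m) (Fin r) ℝ) i j) = T := rfl
  have : IsProbabilityMeasure
      (((gaussMat (Fin k) (Fin r) v).prod (gaussMat (Fin m) (Fin r) v)).map T) :=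
    Measure.isProbabilityMeasure_map (by fun_prop)
  rw [hT]
  refine Measure.ext_of_charFunDual ?_
  ext L
  rw [charFunDual_map, charFunDual_prod, charFunDual_gaussMat, charFunDual_gaussMat,
    charFunDual_gaussMat, ← Complex.exp_add]
  have key : ∀ {l : ℕ} (N : Matrix (Fin m) (Fin l) ℝ) (Z : Matrix (Fin l) (Fin r) ℝ),
      L (N * Z) = ∑ i, ∑ j, (Nᵀ * coeffMat L) i j * Z i j := by
    intro l N Z
    refine (apply_eq_sum_coeffMat L (N * Z)).trans ?_
    simp only [Matrix.mul_apply, Matrix.transpose_apply, Finset.mul_sum, Finset.sum_mul]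
    calc _ = ∑ i, ∑ j, ∑ l, coeffMat L i l * (N i j * Z j l) :=
          Finset.sum_congr rfl fun i _ => Finset.sum_comm
      _ = ∑ j, ∑ l, ∑ i, coeffMat L i l * (N i j * Z j l) := by
          rw [Finset.sum_comm]
          exact Finset.sum_congr rfl fun j _ => Finset.sum_comm
      _ = _ := Finset.sum_congr rfl fun j _ => Finset.sum_congr rfl fun l _ =>
          Finset.sum_congr rfl fun i _ => by ring
  have hz : ∀ {l : ℕ} (N : Matrix (Fin m) (Fin l) ℝ),
      N * (0 : Matrix (Fin l) (Fin r) ℝ) = 0 := fun N => Matrix.mul_zero N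
  have e1 : coeffMat ((L.comp T).comp (.inl ℝ _ _)) = Vᵀ * coeffMat L := by
    refine coeffMat_eq_of_apply fun Z => Eq.trans ?_ (key V (Matrix.of Z))
    have : T (Z, 0) = V * Matrix.of Z := by
      change V * Matrix.of Z + (1 - V * Vᵀ) * (0 : Matrix (Fin m) (Fin r) ℝ) = _
      rw [hz, add_zero]
    exact congrArg L this
  have e2 : coeffMat ((L.comp T).comp (.inr ℝ _ _)) = (1 - V * Vᵀ)ᵀ * coeffMat L := by
    refine coeffMat_eq_of_apply fun Z => Eq.trans ?_ (key (1 - V * Vᵀ) (Matrix.of Z))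
    have : T (0, Z) = ((1 - V * Vᵀ) * Matrix.of Z : Matrix (Fin m) (Fin r) ℝ) := by
      change V * (0 : Matrix (Fin k) (Fin r) ℝ) + (1 - V * Vᵀ) * Matrix.of Z = _
      rw [hz, zero_add]
    exact congrArg L this
  -- Pythagoras makes the exponents of the two independent parts add up to the exponent of a full
  -- Gaussian matrix.
  have e3 : frobSq ((1 - V * Vᵀ)ᵀ * coeffMat L)
      = frobSq (coeffMat L) - frobSq (Vᵀ * coeffMat L) := by
    have h1 : (1 - V * Vᵀ)ᵀ * coeffMat L = coeffMat L - V * Vᵀ * coeffMat L := by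
      simp [Matrix.sub_mul]
    rw [h1, frobSq_sub_projection hV, ← trace_mul_transpose_self (Vᵀ * coeffMat L)]
    simp [Matrix.transpose_mul, Matrix.mul_assoc]
  rw [e1, e2, e3]
  congr 1
  push_cast
  ring

theorem gaussMat_map_dual (L : StrongDual ℝ (ι → κ → ℝ)) :
    (gaussMat ι κ v).map L = gaussianReal 0 (v * (frobSq (coeffMat L)).toNNReal) := by
  have : IsProbabilityMeasure ((gaussMat ι κ v).map L) :=
    Measure.isProbabilityMeasure_map (by fun_prop)
  refine Measure.ext_of_charFun ?_
  ext t
  rw [charFun_map_eq_charFunDual_smul, charFunDual_gaussMat, charFun_gaussianReal]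
  have h : coeffMat (t • L) = t • coeffMat L := by ext i l; rfl
  rw [h, frobSq_smul]
  congr 1
  have : (((frobSq (coeffMat L)).toNNReal : ℝ≥0) : ℝ) = frobSq (coeffMat L) :=
    Real.coe_toNNReal _ (frobSq_nonneg _)
  push_cast
  rw [this]
  ring

theorem lintegral_sq_gaussianReal (v : ℝ≥0) :
    ∫⁻ x, ENNReal.ofReal (x ^ 2) ∂(gaussianReal 0 v) = v := by
  have h1 : Integrable (fun x : ℝ => x ^ 2) (gaussianReal 0 v) :=
    (memLp_id_gaussianReal (μ := 0) (v := v) 2).integrable_sq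
  have h2 : ∫ x, x ^ 2 ∂(gaussianReal 0 v) = v := by
    rw [← variance_id_gaussianReal (μ := 0) (v := v), variance_of_integral_eq_zero]
    · rfl
    · fun_prop
    · simp
  rw [← ofReal_integral_eq_lintegral_ofReal h1 (ae_of_all _ fun x => sq_nonneg x), h2]
  simp

theorem lintegral_sq_dual_gaussMat (L : StrongDual ℝ (ι → κ → ℝ)) :
    ∫⁻ Z, ENNReal.ofReal (L Z ^ 2) ∂(gaussMat ι κ v)
      = ENNReal.ofReal (v * frobSq (coeffMat L)) := by
  have h : ∫⁻ Z, ENNReal.ofReal (L Z ^ 2) ∂(gaussMat ι κ v)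
      = ∫⁻ x, ENNReal.ofReal (x ^ 2) ∂((gaussMat ι κ v).map L) := by
    rw [lintegral_map (by fun_prop) (by fun_prop)]
  rw [h, gaussMat_map_dual, lintegral_sq_gaussianReal, ENNReal.ofReal_mul v.coe_nonneg]
  simp [ENNReal.ofReal]

/-- Entry `(a, b)` of `S Z H` is a linear form in `Z` with coefficients `S a i * H l b`, hence a
centered Gaussian; summing the variances factors the two norms. -/
theorem lintegral_frobSq_mul_mul {m n k r : ℕ} (S : Matrix (Fin n) (Fin m) ℝ)
    (H : Matrix (Fin r) (Fin k) ℝ) :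
    ∫⁻ Z, ENNReal.ofReal (frobSq (S * Matrix.of Z * H)) ∂(gaussMat (Fin m) (Fin r) v)
      = ENNReal.ofReal (v * (frobSq S * frobSq H)) := by
  have hL : ∀ a b, ∃ L : StrongDual ℝ (Fin m → Fin r → ℝ),
      (∀ Z, L Z = (S * Matrix.of Z * H) a b)
        ∧ coeffMat L = Matrix.of fun i l => S a i * H l b := by
    intro a b
    let L₀ : (Fin m → Fin r → ℝ) →ₗ[ℝ] ℝ :=
      { toFun := fun Z => (S * Matrix.of Z * H) a b
        map_add' := fun x y => by
          have : (Matrix.of (x + y) : Matrix (Fin m) (Fin r) ℝ) = Matrix.of x + Matrix.of y := rfl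
          rw [this, Matrix.mul_add, Matrix.add_mul]; rfl
        map_smul' := fun c x => by
          have : (Matrix.of (c • x) : Matrix (Fin m) (Fin r) ℝ) = c • Matrix.of x := rfl
          rw [this, Matrix.mul_smul, Matrix.smul_mul]; rfl }
    refine ⟨LinearMap.toContinuousLinearMap L₀, fun Z => rfl, coeffMat_eq_of_apply fun Z => ?_⟩
    change (S * Matrix.of Z * H) a b = _
    simp only [Matrix.mul_apply, Matrix.of_apply, Finset.sum_mul]
    rw [Finset.sum_comm]
    refine Finset.sum_congr rfl fun i _ => Finset.sum_congr rfl fun l _ => by ring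
  choose L hL1 hL2 using hL
  have h1 : ∀ Z : Fin m → Fin r → ℝ, ENNReal.ofReal (frobSq (S * Matrix.of Z * H))
      = ∑ a, ∑ b, ENNReal.ofReal (L a b Z ^ 2) := fun Z => by
    rw [frobSq_eq_sum, ENNReal.ofReal_sum_of_nonneg (fun a _ => by positivity)]
    refine Finset.sum_congr rfl fun a _ => ?_
    rw [ENNReal.ofReal_sum_of_nonneg (fun b _ => by positivity)]
    simp only [hL1]
  simp only [h1]
  rw [lintegral_finsetSum _ (fun a _ => by fun_prop)]
  have h2 : ∀ a, ∫⁻ Z, ∑ b, ENNReal.ofReal (L a b Z ^ 2) ∂(gaussMat (Fin m) (Fin r) v)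
      = ENNReal.ofReal (∑ b, v * frobSq (coeffMat (L a b))) := fun a => by
    rw [lintegral_finsetSum _ (fun b _ => by fun_prop),
      ENNReal.ofReal_sum_of_nonneg (fun b _ => mul_nonneg v.coe_nonneg (frobSq_nonneg _))]
    simp only [lintegral_sq_dual_gaussMat]
  simp only [h2]
  rw [← ENNReal.ofReal_sum_of_nonneg
    (fun a _ => Finset.sum_nonneg fun b _ => mul_nonneg v.coe_nonneg (frobSq_nonneg _))]
  congr 1
  simp only [← Finset.mul_sum]
  congr 1
  simp only [hL2, frobSq_eq_sum, Matrix.of_apply, mul_pow]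
  rw [Finset.sum_mul]
  refine Finset.sum_congr rfl fun a _ => ?_
  simp only [← Finset.mul_sum, ← Finset.sum_mul]
  rw [Finset.sum_comm (f := fun b i => H i b ^ 2)]

end Gaussian

/-! ### Inverse moments of chi-square variables -/

section ChiSquare

open scoped ENNReal

variable {v : ℝ≥0}

theorem integral_exp_neg_mul_sq_gaussianReal (hv : v ≠ 0) {s : ℝ} (hs : 0 ≤ s) :
    ∫ x, Real.exp (-(s * x ^ 2)) ∂(gaussianReal 0 v) = (√(1 + 2 * s * v))⁻¹ := by
  have hv' : (0 : ℝ) < v := by positivity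
  rw [integral_gaussianReal_eq_integral_smul hv]
  have h1 : ∀ x : ℝ, gaussianPDFReal 0 v x • Real.exp (-(s * x ^ 2))
      = (√(2 * Real.pi * v))⁻¹ * Real.exp (-(s + 1 / (2 * v)) * x ^ 2) := fun x => by
    rw [gaussianPDFReal, smul_eq_mul, mul_assoc, ← Real.exp_add]
    congr 2
    field_simp
    ring
  simp only [h1]
  rw [integral_const_mul, integral_gaussian, ← Real.sqrt_inv, ← Real.sqrt_inv,
    ← Real.sqrt_mul (by positivity)]
  congr 1
  have := Real.pi_pos
  field_simp
  ring

theorem lintegral_exp_neg_mul_sum_sq (hv : v ≠ 0) {s : ℝ} (hs : 0 ≤ s) (d : ℕ) :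
    ∫⁻ y, ENNReal.ofReal (Real.exp (-(s * ∑ i, y i ^ 2))) ∂(gaussVec (Fin d) v)
      = ENNReal.ofReal ((√(1 + 2 * s * v))⁻¹ ^ d) := by
  have h1 : ∀ y : Fin d → ℝ, Real.exp (-(s * ∑ i, y i ^ 2))
      = ∏ i, Real.exp (-(s * y i ^ 2)) := fun y => by
    rw [← Real.exp_sum, Finset.sum_neg_distrib, Finset.mul_sum]
  have h2 : Integrable (fun y : Fin d → ℝ => Real.exp (-(s * ∑ i, y i ^ 2)))
      (gaussVec (Fin d) v) := by
    refine Integrable.of_bound (C := 1) (Measurable.aestronglyMeasurable (by fun_prop))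
      (ae_of_all _ fun y => ?_)
    rw [Real.norm_eq_abs, Real.abs_exp, Real.exp_le_one_iff, neg_nonpos]
    positivity
  rw [← ofReal_integral_eq_lintegral_ofReal h2 (ae_of_all _ fun y => (Real.exp_pos _).le)]
  simp only [h1]
  rw [integral_fintype_prod_eq_pow (fun x => Real.exp (-(s * x ^ 2))),
    integral_exp_neg_mul_sq_gaussianReal hv hs, Fintype.card_fin]

/-- Represents an inverse as a superposition of exponentials, so that inverse moments become
integrals of a Laplace transform. Both sides are `∞` at `q = 0`. -/
theorem lintegral_exp_neg_mul_Ioi (q : ℝ) (hq : 0 ≤ q) :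
    ∫⁻ s in Set.Ioi (0 : ℝ), ENNReal.ofReal (Real.exp (-(s * q))) = (ENNReal.ofReal q)⁻¹ := by
  rcases hq.eq_or_lt with rfl | hq
  · simp
  · have h1 : IntegrableOn (fun s : ℝ => Real.exp (-(s * q))) (Set.Ioi 0) := by
      have := integrableOn_exp_mul_Ioi (a := -q) (by linarith) 0
      refine this.congr_fun (fun s _ => ?_) measurableSet_Ioi
      dsimp only
      congr 1; ring
    rw [← ofReal_integral_eq_lintegral_ofReal h1 (ae_of_all _ fun y => (Real.exp_pos _).le)]
    have h2 : ∫ s in Set.Ioi (0 : ℝ), Real.exp (-(s * q)) = q⁻¹ := by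
      have := integral_exp_mul_Ioi (a := -q) (by linarith) 0
      rw [mul_zero, Real.exp_zero, neg_div_neg_eq, one_div] at this
      rw [← this]
      refine setIntegral_congr_fun measurableSet_Ioi fun s _ => ?_
      congr 1; ring
    rw [h2, ENNReal.ofReal_inv_of_pos hq]

theorem lintegral_exp_neg_mul_sq (q : ℝ) (hq : 0 ≤ q) :
    ∫⁻ t : ℝ, ENNReal.ofReal (Real.exp (-(t ^ 2 * q)))
      = ENNReal.ofReal √Real.pi * (ENNReal.ofReal √q)⁻¹ := by
  have hpi := Real.pi_pos
  rcases hq.eq_or_lt with rfl | hq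
  · have : ENNReal.ofReal √Real.pi ≠ 0 := by
      rw [Ne, ENNReal.ofReal_eq_zero, not_le]; positivity
    simp [ENNReal.mul_top this]
  · have h0 : (fun t : ℝ => Real.exp (-(t ^ 2 * q))) = fun t => Real.exp (-q * t ^ 2) := by
      ext t; congr 1; ring
    have h1 : Integrable (fun t : ℝ => Real.exp (-(t ^ 2 * q))) := by
      rw [h0]; exact integrable_exp_neg_mul_sq hq
    rw [← ofReal_integral_eq_lintegral_ofReal h1 (ae_of_all _ fun y => (Real.exp_pos _).le), h0,
      integral_gaussian, Real.sqrt_div hpi.le, div_eq_mul_inv,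
      ENNReal.ofReal_mul (Real.sqrt_nonneg _), ENNReal.ofReal_inv_of_pos (Real.sqrt_pos.2 hq)]

/-- The first inverse moment of a `χ²` variable with at least three degrees of freedom. -/
theorem lintegral_inv_sum_sq_le (hv : v ≠ 0) {d : ℕ} (hd : 3 ≤ d) :
    ∫⁻ y, (ENNReal.ofReal (∑ i, y i ^ 2))⁻¹ ∂(gaussVec (Fin d) v)
      ≤ ENNReal.ofReal (1 / (v * ((d : ℝ) - 2))) := by
  have hv' : (0 : ℝ) < v := by positivity
  have hd' : (0 : ℝ) < (d : ℝ) - 2 := by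
    have : (3 : ℝ) ≤ d := by exact_mod_cast hd
    linarith
  have h1 : ∫⁻ y, (ENNReal.ofReal (∑ i, y i ^ 2))⁻¹ ∂(gaussVec (Fin d) v)
      = ∫⁻ s in Set.Ioi (0 : ℝ), ENNReal.ofReal ((√(1 + 2 * s * v))⁻¹ ^ d) := by
    calc _ = ∫⁻ y, (∫⁻ s in Set.Ioi (0 : ℝ), ENNReal.ofReal (Real.exp (-(s * ∑ i, y i ^ 2))))
            ∂(gaussVec (Fin d) v) := by
          refine lintegral_congr fun y => ?_
          rw [lintegral_exp_neg_mul_Ioi _ (by positivity)]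
      _ = ∫⁻ s in Set.Ioi (0 : ℝ), ∫⁻ y, ENNReal.ofReal (Real.exp (-(s * ∑ i, y i ^ 2)))
            ∂(gaussVec (Fin d) v) := by
          rw [lintegral_lintegral_swap]
          fun_prop
      _ = _ := setLIntegral_congr_fun measurableSet_Ioi fun s hs =>
          lintegral_exp_neg_mul_sum_sq hv (le_of_lt hs) d
  rw [h1]
  -- An antiderivative of `(1 + 2sv)^{-d/2}`; it tends to `0` because `d > 2`, so the integral is
  -- `-F 0`.
  set F : ℝ → ℝ := fun s => -(1 / (v * ((d : ℝ) - 2))) * (1 + 2 * s * v) ^ (-(((d : ℝ) - 2) / 2))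
    with hF
  have hder : ∀ s ∈ Set.Ici (0 : ℝ), HasDerivAt F ((√(1 + 2 * s * v))⁻¹ ^ d) s := by
    intro s hs
    have hs' : (0 : ℝ) < 1 + 2 * s * v := by
      have : (0 : ℝ) ≤ s := hs
      positivity
    have hu : HasDerivAt (fun s : ℝ => 1 + 2 * s * v) (2 * v) s := by
      have := (((hasDerivAt_id s).const_mul 2).mul_const (v : ℝ)).const_add 1
      simpa using this
    have h2 := (hu.rpow_const (p := -(((d : ℝ) - 2) / 2)) (Or.inl hs'.ne')).const_mul
      (-(1 / (v * ((d : ℝ) - 2))))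
    refine h2.congr_deriv ?_
    have h3 : (√(1 + 2 * s * v))⁻¹ ^ d = (1 + 2 * s * v) ^ (-(((d : ℝ) - 2) / 2) - 1) := by
      rw [inv_pow, ← Real.rpow_natCast (√(1 + 2 * s * v)), Real.sqrt_eq_rpow,
        ← Real.rpow_mul hs'.le, ← Real.rpow_neg hs'.le]
      congr 1; ring
    rw [h3]
    field_simp
  have hlim : Filter.Tendsto F Filter.atTop (nhds 0) := by
    rw [← mul_zero (-(1 / (v * ((d : ℝ) - 2))))]
    refine Filter.Tendsto.const_mul _ ?_
    refine (tendsto_rpow_neg_atTop (by positivity)).comp ?_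
    refine Filter.tendsto_atTop_add_const_left _ _ ?_
    refine Filter.Tendsto.atTop_mul_const hv' ?_
    exact Filter.Tendsto.const_mul_atTop (by norm_num) Filter.tendsto_id
  have hpos : ∀ s ∈ Set.Ioi (0 : ℝ), 0 ≤ (√(1 + 2 * s * v))⁻¹ ^ d := fun s _ => by positivity
  have hint := integrableOn_Ioi_deriv_of_nonneg' hder hpos hlim
  rw [← ofReal_integral_eq_lintegral_ofReal hint
    ((ae_restrict_iff' measurableSet_Ioi).2 (ae_of_all _ hpos)),
    integral_Ioi_of_hasDerivAt_of_nonneg' hder hpos hlim]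
  refine ENNReal.ofReal_le_ofReal (le_of_eq ?_)
  simp [hF]

/-- The first inverse moment of the norm of a planar Gaussian vector. -/
theorem lintegral_inv_sqrt_sum_sq_le (hv : v ≠ 0) :
    ∫⁻ y, (ENNReal.ofReal √(∑ i, y i ^ 2))⁻¹ ∂(gaussVec (Fin 2) v)
      ≤ ENNReal.ofReal (√(Real.pi / (2 * v))) := by
  have hv' : (0 : ℝ) < v := by positivity
  have hpi := Real.pi_pos
  have h0 : ENNReal.ofReal √Real.pi ≠ 0 := by
    rw [Ne, ENNReal.ofReal_eq_zero, not_le]; positivity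
  -- Writing `1/‖y‖` as a Gaussian integral in `t` and exchanging integrals leaves, in two
  -- dimensions, a Cauchy profile.
  have h1 : ENNReal.ofReal √Real.pi
        * ∫⁻ y, (ENNReal.ofReal √(∑ i, y i ^ 2))⁻¹ ∂(gaussVec (Fin 2) v)
      = ∫⁻ t : ℝ, ENNReal.ofReal ((1 + (√(2 * v) * t) ^ 2)⁻¹) := by
    rw [← lintegral_const_mul _ (by fun_prop)]
    calc _ = ∫⁻ y, (∫⁻ t : ℝ, ENNReal.ofReal (Real.exp (-(t ^ 2 * ∑ i, y i ^ 2))))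
            ∂(gaussVec (Fin 2) v) := by
          refine lintegral_congr fun y => ?_
          rw [lintegral_exp_neg_mul_sq _ (by positivity)]
      _ = ∫⁻ t : ℝ, ∫⁻ y, ENNReal.ofReal (Real.exp (-(t ^ 2 * ∑ i, y i ^ 2)))
            ∂(gaussVec (Fin 2) v) := by
          rw [lintegral_lintegral_swap]
          fun_prop
      _ = _ := by
          refine lintegral_congr fun t => ?_
          rw [lintegral_exp_neg_mul_sum_sq hv (sq_nonneg t), inv_pow, Real.sq_sqrt (by positivity),
            mul_pow, Real.sq_sqrt (by positivity)]
          congr 3; ring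
  have h2 : Integrable fun t : ℝ => (1 + (√(2 * v) * t) ^ 2)⁻¹ :=
    integrable_inv_one_add_sq.comp_mul_left' (by positivity)
  have h3 : ∫ t : ℝ, (1 + (√(2 * v) * t) ^ 2)⁻¹ = √Real.pi * √(Real.pi / (2 * v)) := by
    rw [Measure.integral_comp_mul_left (fun t : ℝ => (1 + t ^ 2)⁻¹) (√(2 * v)),
      integral_univ_inv_one_add_sq, abs_of_pos (by positivity), smul_eq_mul,
      Real.sqrt_div hpi.le]
    have := Real.mul_self_sqrt hpi.le
    field_simp
    nlinarith
  rw [← ofReal_integral_eq_lintegral_ofReal h2 (ae_of_all _ fun t => by positivity), h3,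
    ENNReal.ofReal_mul (Real.sqrt_nonneg _)] at h1
  exact ((ENNReal.mul_right_inj h0 ENNReal.ofReal_ne_top).1 h1).le

/-- Jensen's inequality for the square root, for a Lebesgue integral. -/
theorem lintegral_sqrt_le {α : Type*} [MeasurableSpace α] {P : Measure α} [IsProbabilityMeasure P]
    {f : α → ℝ} (hf : Measurable f) (hf0 : ∀ x, 0 ≤ f x) {M : ℝ} (hM : 0 ≤ M)
    (h : ∫⁻ x, ENNReal.ofReal (f x) ∂P ≤ ENNReal.ofReal M) :
    ∫⁻ x, ENNReal.ofReal √(f x) ∂P ≤ ENNReal.ofReal √M := by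
  -- Uses the tangent bound `√f ≤ f/(2a) + a/2`. The strict inequality keeps `a` positive when `M =
  -- 0`.
  have key : ∀ a : ℝ, √M < a → ∫⁻ x, ENNReal.ofReal √(f x) ∂P ≤ ENNReal.ofReal a := by
    intro a ha
    have ha0 : 0 < a := (Real.sqrt_nonneg _).trans_lt ha
    have hMa : M ≤ a ^ 2 := by
      rw [← Real.sq_sqrt hM]; exact pow_le_pow_left₀ (Real.sqrt_nonneg _) ha.le 2
    calc _ ≤ ∫⁻ x, (ENNReal.ofReal (1 / (2 * a)) * ENNReal.ofReal (f x) + ENNReal.ofReal (a / 2))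
            ∂P := by
          refine lintegral_mono fun x => ?_
          rw [← ENNReal.ofReal_mul (by positivity), ← ENNReal.ofReal_add
            (mul_nonneg (by positivity) (hf0 x)) (by positivity)]
          refine ENNReal.ofReal_le_ofReal ?_
          have h1 := Real.sq_sqrt (hf0 x)
          have h2 : 1 / (2 * a) * f x + a / 2 - √(f x) = (√(f x) - a) ^ 2 / (2 * a) := by
            rw [sub_sq, h1]; field_simp; ring
          have h3 : 0 ≤ (√(f x) - a) ^ 2 / (2 * a) := by positivity
          linarith
      _ ≤ ENNReal.ofReal (1 / (2 * a)) * ENNReal.ofReal M + ENNReal.ofReal (a / 2) := by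
          rw [lintegral_add_right _ measurable_const, lintegral_const_mul _ (by fun_prop)]
          simp only [lintegral_const, measure_univ, mul_one]
          gcongr
      _ ≤ _ := by
          rw [← ENNReal.ofReal_mul (by positivity), ← ENNReal.ofReal_add
            (mul_nonneg (by positivity) hM) (by positivity)]
          refine ENNReal.ofReal_le_ofReal ?_
          have : 1 / (2 * a) * M ≤ 1 / (2 * a) * a ^ 2 := by gcongr
          have h2 : 1 / (2 * a) * a ^ 2 = a / 2 := by field_simp
          linarith
  refine ENNReal.le_of_forall_pos_le_add fun ε hε _ => ?_
  have := key (√M + ε) (by simpa using hε)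
  rwa [ENNReal.ofReal_add (Real.sqrt_nonneg _) ε.coe_nonneg, ENNReal.ofReal_coe_nnreal] at this

end ChiSquare

/-! ### The pseudoinverse of a Gaussian matrix -/

section RightInverse

open scoped ENNReal

variable {v : ℝ≥0}

/-- The Moore-Penrose right inverse of a matrix with independent rows. -/
noncomputable def rightInv {k r : ℕ} (G : Matrix (Fin k) (Fin r) ℝ) : Matrix (Fin r) (Fin k) ℝ :=
  Gᵀ * (G * Gᵀ)⁻¹

theorem frobSq_rightInv {k r : ℕ} (G : Matrix (Fin k) (Fin r) ℝ) :
    frobSq (rightInv G) = ∑ j, (G * Gᵀ)⁻¹ j j := by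
  unfold frobSq rightInv
  rw [Matrix.transpose_mul, Matrix.transpose_transpose, Matrix.mul_assoc]
  by_cases h : IsUnit (G * Gᵀ).det
  · rw [← Matrix.mul_assoc G, Matrix.mul_nonsing_inv _ h, Matrix.mul_one, Matrix.trace_transpose]
    rfl
  · rw [Matrix.nonsing_inv_apply_not_isUnit _ h]
    simp

/-- Let `W` be the inverse Gram matrix. Column `j` of `Gᵀ W` has squared norm `W j j`, and `E` maps
it to `W j j • E g_j` because it kills the other rows. Contraction by `E` gives `W j j ≤ 1/‖E
g_j‖²`, stated without division so that degenerate cases are included. -/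
theorem gramInv_diag_bounds {k r d : ℕ} (G : Matrix (Fin k) (Fin r) ℝ) (j : Fin k)
    {E : Matrix (Fin d) (Fin r) ℝ} (hE : E * Eᵀ = 1) (hG : ∀ i, i ≠ j → E *ᵥ G i = 0) :
    0 ≤ (G * Gᵀ)⁻¹ j j ∧
      ((G * Gᵀ)⁻¹ j j) ^ 2 * ∑ b, (E *ᵥ G j) b ^ 2 ≤ (G * Gᵀ)⁻¹ j j := by
  by_cases hu : IsUnit (G * Gᵀ).det
  · set W := (G * Gᵀ)⁻¹ with hW
    set H := rightInv G with hH
    have h1 : Hᵀ * H = Wᵀ := by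
      rw [hH, rightInv, Matrix.transpose_mul, Matrix.transpose_transpose, Matrix.mul_assoc,
        ← Matrix.mul_assoc G, Matrix.mul_nonsing_inv _ hu, Matrix.mul_one]
    have h2 : H.col j ⬝ᵥ H.col j = W j j := by
      have := congrFun (congrFun h1 j) j
      rw [Matrix.mul_apply, Matrix.transpose_apply] at this
      exact this
    have h3 : E *ᵥ H.col j = W j j • (E *ᵥ G j) := by
      have e1 : E *ᵥ H.col j = (E * Gᵀ) *ᵥ W.col j := by
        rw [hH, rightInv, ← Matrix.mulVec_mulVec]
        rfl
      rw [e1]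
      ext b
      simp only [Matrix.mulVec, dotProduct, Pi.smul_apply, smul_eq_mul]
      rw [Finset.sum_eq_single j]
      · rw [mul_comm]; rfl
      · intro i _ hi
        have : (E * Gᵀ) b i = (E *ᵥ G i) b := rfl
        rw [this, hG i hi]; simp
      · simp
    have h4 := dotProduct_mulVec_self_le (N := E) (by rw [hE, Matrix.one_mul]) (H.col j)
    rw [h2, h3] at h4
    refine ⟨?_, ?_⟩
    · rw [← h2]; exact Finset.sum_nonneg fun i _ => mul_self_nonneg _
    · refine le_trans (le_of_eq ?_) h4
      rw [smul_dotProduct, dotProduct_smul, smul_eq_mul, smul_eq_mul, ← mul_assoc, pow_two]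
      congr 1
      simp [dotProduct, pow_two]
  · rw [Matrix.nonsing_inv_apply_not_isUnit _ hu]
    simp

/-- The orthogonal complement of `l` vectors has dimension at least `d`, whether or not they are
independent; the rows of `E` are `d` orthonormal vectors in it. -/
theorem exists_coisometry_perp {l d r : ℕ} (h : l + d = r) (g : Fin l → Fin r → ℝ) :
    ∃ E : Matrix (Fin d) (Fin r) ℝ, E * Eᵀ = 1 ∧ ∀ i, E *ᵥ g i = 0 := by
  set K : Submodule ℝ (EuclideanSpace ℝ (Fin r)) :=
    Submodule.span ℝ (Set.range fun i => WithLp.toLp 2 (g i)) with hK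
  have h1 : Module.finrank ℝ K ≤ l := by
    have := finrank_range_le_card (R := ℝ)
      (fun i => (WithLp.toLp 2 (g i) : EuclideanSpace ℝ (Fin r)))
    rwa [Fintype.card_fin] at this
  have h2 := K.finrank_add_finrank_orthogonal
  rw [finrank_euclideanSpace_fin] at h2
  have hd : d ≤ Module.finrank ℝ Kᗮ := by omega
  set b := stdOrthonormalBasis ℝ Kᗮ with hb
  refine ⟨Matrix.of fun i a => (b (Fin.castLE hd i) : EuclideanSpace ℝ (Fin r)) a, ?_, ?_⟩
  · ext i j
    have h3 := (orthonormal_iff_ite.1 b.orthonormal) (Fin.castLE hd j) (Fin.castLE hd i)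
    rw [Submodule.coe_inner, PiLp.inner_apply] at h3
    rw [Matrix.mul_apply, Matrix.one_apply]
    simp only [Matrix.transpose_apply, Matrix.of_apply]
    have h4 : (Fin.castLE hd j = Fin.castLE hd i) ↔ i = j := by
      rw [(Fin.castLE_injective hd).eq_iff, eq_comm]
    simp only [h4] at h3
    rw [← h3]
    exact Finset.sum_congr rfl fun a _ => rfl
  · intro i
    ext a
    have h5 : inner ℝ (WithLp.toLp 2 (g i)) (b (Fin.castLE hd a) : EuclideanSpace ℝ (Fin r)) = 0 :=
      (Submodule.mem_orthogonal K _).1 (b (Fin.castLE hd a)).2 _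
        (Submodule.subset_span ⟨i, rfl⟩)
    rw [PiLp.inner_apply] at h5
    rw [Matrix.mulVec, dotProduct, Pi.zero_apply, ← h5]
    exact Finset.sum_congr rfl fun a _ => rfl

/-- By Cramer's formula the entry is a continuous function times the inverse of the determinant,
which is measurable although discontinuous at zero. -/
theorem measurable_gramInv {k r : ℕ} (i j : Fin k) :
    Measurable fun G : Fin k → Fin r → ℝ => (Matrix.of G * (Matrix.of G)ᵀ)⁻¹ i j := by
  have hc : Continuous fun G : Fin k → Fin r → ℝ => (Matrix.of G * (Matrix.of G)ᵀ) :=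
    Continuous.matrix_mul continuous_id (Continuous.matrix_transpose continuous_id)
  simp only [Matrix.inv_def, Ring.inverse_eq_inv', Matrix.smul_apply, smul_eq_mul]
  exact (hc.matrix_det.measurable.inv).mul (hc.matrix_adjugate.matrix_elem i j).measurable

theorem measurePreserving_insertNth_gaussMat {k r : ℕ} (j : Fin (k + 1)) :
    MeasurePreserving
      (fun q : (Fin k → Fin r → ℝ) × (Fin r → ℝ) =>
        (Fin.insertNth j q.2 q.1 : Fin (k + 1) → Fin r → ℝ))
      ((gaussMat (Fin k) (Fin r) v).prod (gaussVec (Fin r) v))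
      (gaussMat (Fin (k + 1)) (Fin r) v) :=
  (measurePreserving_piFinSuccAbove (fun _ : Fin (k + 1) => gaussVec (Fin r) v) j).symm.comp
    Measure.measurePreserving_swap

/-- Any functional of a diagonal entry of the inverse Gram matrix that is controlled by the squared
distance of a row to the span of the others is controlled by a `χ²` variable. -/
theorem lintegral_gramInv_le {k d r : ℕ} (h : k + d = r) (j : Fin (k + 1)) {f F : ℝ → ℝ≥0∞}
    (hf : Measurable f) (hF : Measurable F)
    (hfF : ∀ w q : ℝ, 0 ≤ w → 0 ≤ q → w ^ 2 * q ≤ w → f w ≤ F q) :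
    ∫⁻ G, f ((Matrix.of G * (Matrix.of G)ᵀ)⁻¹ j j) ∂(gaussMat (Fin (k + 1)) (Fin r) v)
      ≤ ∫⁻ y, F (∑ b, y b ^ 2) ∂(gaussVec (Fin d) v) := by
  have hmp := measurePreserving_insertNth_gaussMat (v := v) (r := r) j
  set Φ : (Fin (k + 1) → Fin r → ℝ) → ℝ≥0∞ :=
    fun G => f ((Matrix.of G * (Matrix.of G)ᵀ)⁻¹ j j) with hΦ
  have hmeas : Measurable Φ := hf.comp (measurable_gramInv j j)
  rw [← hmp.lintegral_comp hmeas, lintegral_prod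
    (fun q : (Fin k → Fin r → ℝ) × (Fin r → ℝ) => Φ (Fin.insertNth j q.2 q.1))
    (hmeas.comp hmp.measurable).aemeasurable]
  -- Conditionally on the other rows `g`. The coisometry `E` depends on `g`, but the law of `E y`
  -- does not.
  have hin : ∀ g : Fin k → Fin r → ℝ, ∫⁻ y, Φ (Fin.insertNth j y g) ∂(gaussVec (Fin r) v)
      ≤ ∫⁻ y, F (∑ b, y b ^ 2) ∂(gaussVec (Fin d) v) := by
    intro g
    obtain ⟨E, hE, hEg⟩ := exists_coisometry_perp h g
    rw [← gaussVec_map_of_coisometry (v := v) hE, lintegral_map (by fun_prop)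
      (Continuous.measurable (by fun_prop))]
    refine lintegral_mono fun y => ?_
    set G : Fin (k + 1) → Fin r → ℝ := Fin.insertNth j y g with hG
    have hGj : G j = y := by simp [hG]
    have hGi : ∀ i, i ≠ j → E *ᵥ G i = 0 := by
      intro i hi
      obtain ⟨i', rfl⟩ := Fin.exists_succAbove_eq hi
      have : G (j.succAbove i') = g i' := by simp [hG]
      rw [this, hEg]
    have hb := gramInv_diag_bounds (Matrix.of G) j hE hGi
    have hGj' : (Matrix.of G) j = y := hGj
    rw [hGj'] at hb
    exact hfF _ _ hb.1 (by positivity) hb.2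
  calc _ ≤ ∫⁻ _, (∫⁻ y, F (∑ b, y b ^ 2) ∂(gaussVec (Fin d) v)) ∂(gaussMat (Fin k) (Fin r) v) :=
        lintegral_mono hin
    _ = _ := by simp

theorem sqrt_sum_le_sum_sqrt {ι : Type*} [Fintype ι] (f : ι → ℝ) (hf : ∀ i, 0 ≤ f i) :
    √(∑ i, f i) ≤ ∑ i, √(f i) := by
  rw [Real.sqrt_le_iff]
  refine ⟨Finset.sum_nonneg fun i _ => Real.sqrt_nonneg _, ?_⟩
  have := Finset.sum_sq_le_sq_sum_of_nonneg (s := Finset.univ) (f := fun i => √(f i))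
    (fun i _ => Real.sqrt_nonneg _)
  simpa only [Real.sq_sqrt (hf _)] using this

/-- The expected Frobenius norm of the right inverse of a `k × r` Gaussian matrix with entries of
variance `1 / r` is at most a constant times `√r`. -/
theorem lintegral_frob_rightInv_le {c : ℝ} (hc : 1 < c) {k r : ℕ} (hk : 1 ≤ k)
    (hr : c * k ≤ r) :
    ∫⁻ G, ENNReal.ofReal √(frobSq (rightInv (Matrix.of G)))
        ∂(gaussMat (Fin k) (Fin r) (r : ℝ≥0)⁻¹)
      ≤ ENNReal.ofReal (√r * (√(2 / (c - 1)) + √(Real.pi / 2) / (c - 1))) := by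
  obtain ⟨k, rfl⟩ : ∃ l, k = l + 1 := ⟨k - 1, by omega⟩
  have hc1 : 0 < c - 1 := by linarith
  have hkR : (0 : ℝ) < (k : ℝ) + 1 := by positivity
  push_cast at hr
  have hkr : k + 1 < r := by
    have : ((k + 1 : ℕ) : ℝ) < r := by push_cast; nlinarith
    exact_mod_cast this
  have hrR : (0 : ℝ) < r := by
    have : 0 < r := by omega
    exact_mod_cast this
  have hv : ((r : ℝ≥0)⁻¹) ≠ 0 := by
    rw [Ne, inv_eq_zero]
    exact_mod_cast hrR.ne'
  have hvR : (((r : ℝ≥0)⁻¹ : ℝ≥0) : ℝ) = (r : ℝ)⁻¹ := by simp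
  obtain ⟨d, hd⟩ : ∃ d, k + d = r := ⟨r - k, by omega⟩
  have hdR : (d : ℝ) = r - k := by rw [← hd]; push_cast; ring
  have hpi := Real.pi_pos
  have hmeasW : ∀ j, Measurable fun G : Fin (k + 1) → Fin r → ℝ =>
      (Matrix.of G * (Matrix.of G)ᵀ)⁻¹ j j := fun j => measurable_gramInv j j
  have hW0 : ∀ (G : Fin (k + 1) → Fin r → ℝ) j, 0 ≤ (Matrix.of G * (Matrix.of G)ᵀ)⁻¹ j j :=
    fun G j => (gramInv_diag_bounds (d := 0) (Matrix.of G) j (E := 0)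
      (Subsingleton.elim _ _) (fun _ _ => Subsingleton.elim _ _)).1
  simp only [frobSq_rightInv]
  -- `d` counts degrees of freedom. For `d = 2` the inverse `χ²` variable has infinite mean, so
  -- roots are taken entrywise before integrating; this costs a factor `k + 1`.
  rcases (show 2 ≤ d by omega).eq_or_lt with hd2 | hd3
  · subst hd2
    have h1 : ∀ j : Fin (k + 1), ∫⁻ G, ENNReal.ofReal √((Matrix.of G * (Matrix.of G)ᵀ)⁻¹ j j)
        ∂(gaussMat (Fin (k + 1)) (Fin r) (r : ℝ≥0)⁻¹) ≤ ENNReal.ofReal (√r * √(Real.pi / 2)) := by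
      intro j
      refine (lintegral_gramInv_le hd j (f := fun w => ENNReal.ofReal √w)
        (F := fun q => (ENNReal.ofReal √q)⁻¹) (by fun_prop) (by fun_prop) ?_).trans ?_
      · intro w q hw hq h
        rw [ENNReal.le_inv_iff_mul_le, ← ENNReal.ofReal_mul (Real.sqrt_nonneg _),
          ← Real.sqrt_mul hw, ENNReal.ofReal_le_one, Real.sqrt_le_one]
        rcases hw.eq_or_lt with rfl | hw
        · simp
        · nlinarith
      · refine (lintegral_inv_sqrt_sum_sq_le hv).trans (ENNReal.ofReal_le_ofReal (le_of_eq ?_))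
        rw [hvR, ← Real.sqrt_mul hrR.le]
        congr 1; field_simp
    calc _ ≤ ∫⁻ G, ∑ j, ENNReal.ofReal √((Matrix.of G * (Matrix.of G)ᵀ)⁻¹ j j)
          ∂(gaussMat (Fin (k + 1)) (Fin r) (r : ℝ≥0)⁻¹) := by
          refine lintegral_mono fun G => ?_
          rw [← ENNReal.ofReal_sum_of_nonneg fun j _ => Real.sqrt_nonneg _]
          exact ENNReal.ofReal_le_ofReal (sqrt_sum_le_sum_sqrt _ (hW0 G))
      _ = ∑ j, ∫⁻ G, ENNReal.ofReal √((Matrix.of G * (Matrix.of G)ᵀ)⁻¹ j j)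
          ∂(gaussMat (Fin (k + 1)) (Fin r) (r : ℝ≥0)⁻¹) :=
          lintegral_finsetSum _ fun j _ => (hmeasW j).sqrt.ennreal_ofReal
      _ ≤ ∑ _j : Fin (k + 1), ENNReal.ofReal (√r * √(Real.pi / 2)) :=
          Finset.sum_le_sum fun j _ => h1 j
      _ = ENNReal.ofReal (∑ _j : Fin (k + 1), √r * √(Real.pi / 2)) := by
          rw [ENNReal.ofReal_sum_of_nonneg fun _ _ => by positivity]
      _ ≤ _ := by
          refine ENNReal.ofReal_le_ofReal ?_
          rw [Finset.sum_const, Finset.card_univ, Fintype.card_fin, nsmul_eq_mul]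
          push_cast
          -- Here `c (k + 1) ≤ r = k + 2`, so the number of rows is bounded in terms of `c`.
          have h2 : ((k : ℝ) + 1) ≤ 1 / (c - 1) := by
            rw [le_div_iff₀ hc1]
            have : (r : ℝ) = k + 2 := by rw [← hd]; push_cast; ring
            nlinarith
          calc ((k : ℝ) + 1) * (√r * √(Real.pi / 2)) ≤ 1 / (c - 1) * (√r * √(Real.pi / 2)) := by
                gcongr
            _ = √r * (0 + √(Real.pi / 2) / (c - 1)) := by ring
            _ ≤ _ := by gcongr; positivity
  · have hd3R : (3 : ℝ) ≤ d := by exact_mod_cast hd3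
    have hd2' : (0 : ℝ) < (d : ℝ) - 2 := by linarith
    have h1 : ∀ j : Fin (k + 1), ∫⁻ G, ENNReal.ofReal ((Matrix.of G * (Matrix.of G)ᵀ)⁻¹ j j)
        ∂(gaussMat (Fin (k + 1)) (Fin r) (r : ℝ≥0)⁻¹) ≤ ENNReal.ofReal (r / ((d : ℝ) - 2)) := by
      intro j
      refine (lintegral_gramInv_le hd j (f := fun w => ENNReal.ofReal w)
        (F := fun q => (ENNReal.ofReal q)⁻¹) (by fun_prop) (by fun_prop) ?_).trans ?_
      · intro w q hw hq h
        rw [ENNReal.le_inv_iff_mul_le, ← ENNReal.ofReal_mul hw, ENNReal.ofReal_le_one]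
        rcases hw.eq_or_lt with rfl | hw
        · simp
        · nlinarith
      · refine (lintegral_inv_sum_sq_le hv hd3).trans (ENNReal.ofReal_le_ofReal (le_of_eq ?_))
        rw [hvR]
        field_simp
    have h2 : ∫⁻ G, ENNReal.ofReal (∑ j, (Matrix.of G * (Matrix.of G)ᵀ)⁻¹ j j)
        ∂(gaussMat (Fin (k + 1)) (Fin r) (r : ℝ≥0)⁻¹)
        ≤ ENNReal.ofReal (((k : ℝ) + 1) * (r / ((d : ℝ) - 2))) := by
      calc _ = ∑ j, ∫⁻ G, ENNReal.ofReal ((Matrix.of G * (Matrix.of G)ᵀ)⁻¹ j j)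
            ∂(gaussMat (Fin (k + 1)) (Fin r) (r : ℝ≥0)⁻¹) := by
            rw [← lintegral_finsetSum _ fun j _ => (hmeasW j).ennreal_ofReal]
            exact lintegral_congr fun G => ENNReal.ofReal_sum_of_nonneg fun j _ => hW0 G j
        _ ≤ ∑ _j : Fin (k + 1), ENNReal.ofReal (r / ((d : ℝ) - 2)) :=
            Finset.sum_le_sum fun j _ => h1 j
        _ = ENNReal.ofReal (∑ _j : Fin (k + 1), r / ((d : ℝ) - 2)) := by
            rw [ENNReal.ofReal_sum_of_nonneg fun _ _ => by positivity]
        _ = _ := by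
            rw [Finset.sum_const, Finset.card_univ, Fintype.card_fin, nsmul_eq_mul]
            push_cast
            rfl
    refine (lintegral_sqrt_le (Finset.measurable_sum _ fun j _ => hmeasW j)
      (fun G => Finset.sum_nonneg fun j _ => hW0 G j) (by positivity) h2).trans
      (ENNReal.ofReal_le_ofReal ?_)
    have h3 : ((k : ℝ) + 1) * (r / ((d : ℝ) - 2)) ≤ r * (2 / (c - 1)) := by
      rw [mul_div_assoc', mul_div_assoc', div_le_div_iff₀ hd2' hc1]
      -- The left side is at most `r - (k + 1) = d - 1`, and `d - 1 ≤ 2(d - 2)` since `d ≥ 3`.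
      have : ((k : ℝ) + 1) * (c - 1) ≤ 2 * ((d : ℝ) - 2) := by rw [hdR] at hd3R ⊢; nlinarith
      nlinarith [mul_le_mul_of_nonneg_left this hrR.le]
    calc _ ≤ √(r * (2 / (c - 1))) := Real.sqrt_le_sqrt h3
      _ = √r * (√(2 / (c - 1)) + 0) := by rw [Real.sqrt_mul hrR.le, add_zero]
      _ ≤ _ := by gcongr; positivity

/-- The rows of a Gaussian matrix are almost surely linearly independent. -/
theorem ae_linearIndependent_gaussMat (hv : v ≠ 0) {k r : ℕ} (hkr : k ≤ r) :
    ∀ᵐ G ∂(gaussMat (Fin k) (Fin r) v), LinearIndependent ℝ G := by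
  induction k with
  | zero => exact ae_of_all _ fun G => linearIndependent_empty_type
  | succ k ih =>
    have hmp := measurePreserving_insertNth_gaussMat (v := v) (k := k) (r := r) 0
    have hset : MeasurableSet {G : Fin (k + 1) → Fin r → ℝ | LinearIndependent ℝ G} :=
      isOpen_setOfPred_linearIndependent.measurableSet
    have hae : ∀ᵐ q ∂((gaussMat (Fin k) (Fin r) v).prod (gaussVec (Fin r) v)),
        LinearIndependent ℝ (Fin.insertNth 0 q.2 q.1 : Fin (k + 1) → Fin r → ℝ) := by
      refine (Measure.ae_prod_iff_ae_ae (p := fun q : (Fin k → Fin r → ℝ) × (Fin r → ℝ) =>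
        LinearIndependent ℝ (Fin.insertNth 0 q.2 q.1 : Fin (k + 1) → Fin r → ℝ))
        (hmp.measurable hset)).2 ?_
      filter_upwards [ih (by omega)] with g hg
      -- A new row in the span of the old ones would be killed by `E`, while the first coordinate of
      -- `E y` is a nondegenerate Gaussian.
      obtain ⟨E, hE, hEg⟩ := exists_coisometry_perp (d := r - k) (by omega) g
      have h0 : ∀ᵐ y ∂(gaussVec (Fin (r - k)) v), y ⟨0, by omega⟩ ≠ 0 := by
        have : NullSingletonClass (gaussianReal 0 v) := nullSingletonClass_gaussianReal hv
        exact Measure.ae_eval_ne (μ := fun _ => gaussianReal 0 v) _ 0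
      rw [← gaussVec_map_of_coisometry (v := v) hE] at h0
      have h1 := ae_of_ae_map (Continuous.aemeasurable (by fun_prop)) h0
      filter_upwards [h1] with y hy
      rw [Fin.insertNth_zero', linearIndependent_finCons]
      refine ⟨hg, fun hmem => hy ?_⟩
      have : E *ᵥ y = 0 := by
        refine Submodule.span_induction (p := fun z _ => E *ᵥ z = 0) ?_ ?_ ?_ ?_ hmem
        · rintro _ ⟨i, rfl⟩; exact hEg i
        · simp
        · intro a b _ _ ha hb; rw [Matrix.mulVec_add, ha, hb, add_zero]
        · intro t a _ ha; rw [Matrix.mulVec_smul, ha, smul_zero]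
      rw [this]; rfl
    have h2 := (ae_map_iff hmp.measurable.aemeasurable hset).2 hae
    rwa [hmp.map_eq] at h2

theorem mul_rightInv {k r : ℕ} {G : Matrix (Fin k) (Fin r) ℝ} (hG : LinearIndependent ℝ G) :
    G * rightInv G = 1 := by
  have h1 : (G * Gᵀ).rank = Fintype.card (Fin k) := by
    rw [Matrix.rank_self_mul_transpose]
    exact LinearIndependent.rank_matrix hG
  have h2 : IsUnit (G * Gᵀ).det := by
    rw [← Matrix.isUnit_iff_isUnit_det]
    rw [← Matrix.linearIndependent_rows_iff_isUnit, linearIndependent_iff_card_eq_finrank_span,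
      ← h1, Matrix.rank_eq_finrank_span_row]
    rfl
  rw [rightInv, ← Matrix.mul_assoc, Matrix.mul_nonsing_inv _ h2]

end RightInverse

/-! ### The expected excess error of the sketch -/

section Sketch

open scoped ENNReal

variable {v : ℝ≥0}

theorem measurable_mul_apply {α ι κ κ' : Type*} [MeasurableSpace α] [Fintype κ]
    {A : α → Matrix ι κ ℝ} {B : α → Matrix κ κ' ℝ} (hA : ∀ i j, Measurable fun ω => A ω i j)
    (hB : ∀ i j, Measurable fun ω => B ω i j) (i : ι) (j : κ') :
    Measurable fun ω => (A ω * B ω) i j := by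
  simp only [Matrix.mul_apply]
  exact Finset.measurable_sum _ fun l _ => (hA i l).mul (hB l j)

theorem measurable_frobSq {α ι κ : Type*} [MeasurableSpace α] [Fintype ι] [Fintype κ]
    {A : α → Matrix ι κ ℝ} (hA : ∀ i j, Measurable fun ω => A ω i j) :
    Measurable fun ω => frobSq (A ω) := by
  simp only [frobSq_eq_sum]
  exact Finset.measurable_sum _ fun i _ => Finset.measurable_sum _ fun j _ => (hA i j).pow_const 2

theorem measurable_of_apply {k r : ℕ} (i : Fin k) (j : Fin r) :
    Measurable fun G : Fin k → Fin r → ℝ => Matrix.of G i j :=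
  (measurable_pi_apply j).comp (measurable_pi_apply i)

theorem measurable_rightInv_apply {α : Type*} [MeasurableSpace α] {k r : ℕ}
    {A : α → Matrix (Fin k) (Fin r) ℝ} (hA : ∀ i j, Measurable fun ω => A ω i j) (i : Fin r)
    (j : Fin k) : Measurable fun ω => rightInv (A ω) i j := by
  have h : Measurable fun ω a b => A ω a b :=
    measurable_pi_iff.2 fun a => measurable_pi_iff.2 fun b => hA a b
  exact measurable_mul_apply (fun a b => hA b a) (fun a b => (measurable_gramInv a b).comp h) i j

theorem measurable_frob_sketch {n m k r : ℕ} (S : Matrix (Fin n) (Fin m) ℝ)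
    (V : Matrix (Fin m) (Fin k) ℝ) :
    Measurable fun Ω : Fin m → Fin r → ℝ =>
      √(frobSq (S * Matrix.of Ω * rightInv (Vᵀ * Matrix.of Ω))) := by
  have h1 := measurable_mul_apply (A := fun _ : Fin m → Fin r → ℝ => S)
    (fun _ _ => measurable_const) measurable_of_apply
  have h2 := measurable_mul_apply (A := fun _ : Fin m → Fin r → ℝ => Vᵀ)
    (fun _ _ => measurable_const) measurable_of_apply
  exact (measurable_frobSq (measurable_mul_apply h1 (measurable_rightInv_apply h2))).sqrt

theorem measurable_add_gaussMat {m k r : ℕ} (V : Matrix (Fin m) (Fin k) ℝ) :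
    Measurable fun (q : (Fin k → Fin r → ℝ) × (Fin m → Fin r → ℝ)) i j =>
      (V * Matrix.of q.1 + (1 - V * Vᵀ) * Matrix.of q.2 : Matrix (Fin m) (Fin r) ℝ) i j :=
  measurable_pi_iff.2 fun i => measurable_pi_iff.2 fun j =>
    (measurable_mul_apply (A := fun _ => V) (fun _ _ => measurable_const)
      (fun a b => (measurable_of_apply a b).comp measurable_fst) i j).add
    (measurable_mul_apply (A := fun _ => 1 - V * Vᵀ) (fun _ _ => measurable_const)
      (fun a b => (measurable_of_apply a b).comp measurable_snd) i j)

theorem lintegral_gaussMat_eq_prod {m k r : ℕ} {V : Matrix (Fin m) (Fin k) ℝ} (hV : Vᵀ * V = 1)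
    {Ψ : Matrix (Fin m) (Fin r) ℝ → ℝ≥0∞}
    (hΨ : Measurable fun Ω : Fin m → Fin r → ℝ => Ψ (Matrix.of Ω)) :
    ∫⁻ Ω, Ψ (Matrix.of Ω) ∂(gaussMat (Fin m) (Fin r) v)
      = ∫⁻ q, Ψ (V * Matrix.of q.1 + (1 - V * Vᵀ) * Matrix.of q.2)
        ∂((gaussMat (Fin k) (Fin r) v).prod (gaussMat (Fin m) (Fin r) v)) := by
  have h := lintegral_map (μ := (gaussMat (Fin k) (Fin r) v).prod (gaussMat (Fin m) (Fin r) v))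
    hΨ (measurable_add_gaussMat V)
  rw [gaussMat_map_add hV] at h
  exact h

theorem transpose_mul_add {m k r : ℕ} {V : Matrix (Fin m) (Fin k) ℝ} (hV : Vᵀ * V = 1)
    (G : Matrix (Fin k) (Fin r) ℝ) (Z : Matrix (Fin m) (Fin r) ℝ) :
    Vᵀ * (V * G + (1 - V * Vᵀ) * Z) = G := by
  have h : Vᵀ * (1 - V * Vᵀ) = 0 := by
    rw [Matrix.mul_sub, ← Matrix.mul_assoc, hV, Matrix.one_mul, Matrix.mul_one, sub_self]
  rw [Matrix.mul_add, ← Matrix.mul_assoc, hV, Matrix.one_mul, ← Matrix.mul_assoc, h,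
    Matrix.zero_mul, add_zero]

/-- The projection of a Gaussian matrix on an isometry is Gaussian. -/
theorem ae_transpose_mul {m k r : ℕ} {V : Matrix (Fin m) (Fin k) ℝ} (hV : Vᵀ * V = 1)
    {p : Matrix (Fin k) (Fin r) ℝ → Prop}
    (hp : MeasurableSet {G : Fin k → Fin r → ℝ | p (Matrix.of G)})
    (h : ∀ᵐ G ∂(gaussMat (Fin k) (Fin r) v), p (Matrix.of G)) :
    ∀ᵐ Ω ∂(gaussMat (Fin m) (Fin r) v), p (Vᵀ * Matrix.of Ω) := by
  have h1 : Measurable fun (Ω : Fin m → Fin r → ℝ) (i : Fin k) (j : Fin r) =>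
      (Vᵀ * Matrix.of Ω) i j :=
    measurable_pi_iff.2 fun i => measurable_pi_iff.2 fun j =>
      measurable_mul_apply (A := fun _ => Vᵀ) (fun _ _ => measurable_const) measurable_of_apply i j
  have hset : MeasurableSet {Ω : Fin m → Fin r → ℝ | p (Vᵀ * Matrix.of Ω)} := h1 hp
  have h2 : ∀ᵐ q ∂((gaussMat (Fin k) (Fin r) v).prod (gaussMat (Fin m) (Fin r) v)),
      p (Vᵀ * (V * Matrix.of q.1 + (1 - V * Vᵀ) * Matrix.of q.2)) := by
    filter_upwards [(Measure.quasiMeasurePreserving_fst (μ := gaussMat (Fin k) (Fin r) v)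
      (ν := gaussMat (Fin m) (Fin r) v)).ae h] with q hq
    rwa [transpose_mul_add hV]
  rw [← gaussMat_map_add hV]
  exact (ae_map_iff (measurable_add_gaussMat V).aemeasurable hset).2 h2

/-- The expected excess error of the sketched projection. -/
theorem lintegral_frob_sketch_le {c : ℝ} (hc : 1 < c) {n m k r : ℕ} (hk : 1 ≤ k)
    (hr : c * k ≤ r) {V : Matrix (Fin m) (Fin k) ℝ} (hV : Vᵀ * V = 1)
    {S : Matrix (Fin n) (Fin m) ℝ} (hS : S * V = 0) :
    ∫⁻ Ω, ENNReal.ofReal √(frobSq (S * Matrix.of Ω * rightInv (Vᵀ * Matrix.of Ω)))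
        ∂(gaussMat (Fin m) (Fin r) (r : ℝ≥0)⁻¹)
      ≤ ENNReal.ofReal (√(frobSq S) * (√(2 / (c - 1)) + √(Real.pi / 2) / (c - 1))) := by
  have hrR : (0 : ℝ) < r := by
    have : (1 : ℝ) ≤ k := by exact_mod_cast hk
    nlinarith
  have hmeas := measurable_frob_sketch (r := r) S V
  -- `SΩ` depends on `Z` alone, and `VᵀΩ` equals `G`: this is the independence that allows
  -- integrating over `Z` with `G` fixed.
  have hSm : ∀ (G : Matrix (Fin k) (Fin r) ℝ) (Z : Matrix (Fin m) (Fin r) ℝ),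
      S * (V * G + (1 - V * Vᵀ) * Z) = S * Z := fun G Z => by
    have h : S * (1 - V * Vᵀ) = S := by
      rw [Matrix.mul_sub, ← Matrix.mul_assoc, hS, Matrix.zero_mul, Matrix.mul_one, sub_zero]
    rw [Matrix.mul_add, ← Matrix.mul_assoc, hS, Matrix.zero_mul, ← Matrix.mul_assoc, h, zero_add]
  have hm2 : Measurable fun q : (Fin k → Fin r → ℝ) × (Fin m → Fin r → ℝ) =>
      ENNReal.ofReal √(frobSq (S * Matrix.of q.2 * rightInv (Matrix.of q.1))) :=
    (measurable_frobSq (measurable_mul_apply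
      (measurable_mul_apply (A := fun _ => S) (fun _ _ => measurable_const)
        fun a b => (measurable_of_apply a b).comp measurable_snd)
      (measurable_rightInv_apply
        fun a b => (measurable_of_apply a b).comp measurable_fst))).sqrt.ennreal_ofReal
  have hprod := lintegral_gaussMat_eq_prod (v := (r : ℝ≥0)⁻¹) hV
    (Ψ := fun Ω => ENNReal.ofReal √(frobSq (S * Ω * rightInv (Vᵀ * Ω)))) hmeas.ennreal_ofReal
  simp only [transpose_mul_add hV, hSm] at hprod
  rw [hprod, lintegral_prod _ hm2.aemeasurable]
  have hin : ∀ G : Fin k → Fin r → ℝ,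
      ∫⁻ Z, ENNReal.ofReal √(frobSq (S * Matrix.of Z * rightInv (Matrix.of G)))
        ∂(gaussMat (Fin m) (Fin r) (r : ℝ≥0)⁻¹)
      ≤ ENNReal.ofReal (√((r : ℝ)⁻¹) * √(frobSq S))
        * ENNReal.ofReal √(frobSq (rightInv (Matrix.of G))) := fun G => by
    have hm3 : Measurable fun Z : Fin m → Fin r → ℝ =>
        frobSq (S * Matrix.of Z * rightInv (Matrix.of G)) :=
      measurable_frobSq (measurable_mul_apply (B := fun _ => rightInv (Matrix.of G))
        (measurable_mul_apply (A := fun _ => S) (fun _ _ => measurable_const) measurable_of_apply)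
        fun _ _ => measurable_const)
    refine (lintegral_sqrt_le (M := (r : ℝ)⁻¹ * (frobSq S * frobSq (rightInv (Matrix.of G))))
      hm3 (fun _ => frobSq_nonneg _) (mul_nonneg (by positivity)
        (mul_nonneg (frobSq_nonneg _) (frobSq_nonneg _))) ?_).trans (le_of_eq ?_)
    · rw [lintegral_frobSq_mul_mul]; simp
    · rw [← ENNReal.ofReal_mul (by positivity), Real.sqrt_mul (by positivity),
        Real.sqrt_mul (frobSq_nonneg _), mul_assoc]
  refine (lintegral_mono hin).trans ?_
  rw [lintegral_const_mul _ (measurable_frobSq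
    (measurable_rightInv_apply measurable_of_apply)).sqrt.ennreal_ofReal]
  refine (mul_le_mul_right (lintegral_frob_rightInv_le hc hk hr) _).trans (le_of_eq ?_)
  rw [← ENNReal.ofReal_mul (by positivity)]
  congr 1
  have : √((r : ℝ)⁻¹) * √r = 1 := by
    rw [← Real.sqrt_mul (by positivity), inv_mul_cancel₀ hrR.ne', Real.sqrt_one]
  linear_combination √(frobSq S) * (√(2 / (c - 1)) + √(Real.pi / 2) / (c - 1)) * this

end Sketch

/-! ### Measurability and sign of the gap -/

section Measurability

variable {p n m : ℕ}

theorem measurable_mulVec_apply {α ι : Type*} [MeasurableSpace α] {A : α → Matrix ι (Fin n) ℝ}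
    (hA : ∀ a b, Measurable fun ω => A ω a b) (y : Fin n → ℝ) (a : ι) :
    Measurable fun ω => (A ω *ᵥ y) a := by
  simp only [Matrix.mulVec, dotProduct]
  exact Finset.measurable_sum _ fun l _ => (hA a l).mul_const _

theorem measurable_predict {α : Type*} [MeasurableSpace α] {W : α → Matrix (Fin p) (Fin n) ℝ}
    (hW : ∀ a b, Measurable fun ω => W ω a b) (y : Fin n → ℝ) :
    Measurable fun ω => predict (W ω) y :=
  (MeasurableEquiv.toLp 2 (Fin p → ℝ)).measurable.comp
    (measurable_pi_iff.2 fun c => measurable_mulVec_apply hW y c)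

theorem measurable_iterate_apply {α : Type*} [MeasurableSpace α] {T : ℕ} (x : Fin m → Fin n → ℝ)
    {g : Fin m → EuclideanSpace ℝ (Fin p) → EuclideanSpace ℝ (Fin p)}
    (hg : ∀ i, Measurable (g i)) (η : ℝ) {A : α → Matrix (Fin n) (Fin n) ℝ}
    (hA : ∀ a b, Measurable fun ω => A ω a b) (i : Fin T → Fin m) (t : ℕ) :
    ∀ a b, Measurable fun ω => iterate x g η (A ω) i t a b := by
  induction t with
  | zero => exact fun a b => measurable_const
  | succ t ih =>
    intro a b
    unfold iterate
    split_ifs with h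
    · have h1 := measurable_predict ih (x (i ⟨t, h⟩))
      have h2 : Measurable fun ω => (g (i ⟨t, h⟩)
          (predict (iterate x g η (A ω) i t) (x (i ⟨t, h⟩)))).ofLp a :=
        (measurable_pi_apply a).comp
          ((MeasurableEquiv.toLp 2 (Fin p → ℝ)).symm.measurable.comp ((hg _).comp h1))
      have h3 : Measurable fun ω => (A ω *ᵥ x (i ⟨t, h⟩)) b :=
        measurable_mulVec_apply hA _ b
      exact (ih a b).sub ((h2.mul h3).const_mul η)
    · exact ih a b

theorem measurable_expectedGap {α : Type*} [MeasurableSpace α] (T : ℕ) (x : Fin m → Fin n → ℝ)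
    {ℓ : Fin m → EuclideanSpace ℝ (Fin p) → ℝ} (hℓ : ∀ i, Measurable (ℓ i))
    {g : Fin m → EuclideanSpace ℝ (Fin p) → EuclideanSpace ℝ (Fin p)}
    (hg : ∀ i, Measurable (g i)) (η : ℝ) {A : α → Matrix (Fin n) (Fin n) ℝ}
    (hA : ∀ a b, Measurable fun ω => A ω a b) (Wstar : Matrix (Fin p) (Fin n) ℝ) :
    Measurable fun ω => expectedGap x ℓ g η T (A ω) Wstar := by
  unfold expectedGap
  refine (Finset.measurable_sum _ fun i _ => Measurable.sub_const ?_ _).const_mul _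
  unfold empLoss
  refine (Finset.measurable_sum _ fun j _ =>
    (hℓ j).comp (measurable_predict (fun a b => ?_) _)).const_mul _
  unfold averaged
  simp only [Matrix.smul_apply, Matrix.sum_apply, smul_eq_mul]
  exact (Finset.measurable_sum _ fun t _ =>
    measurable_iterate_apply x hg η hA i t a b).const_mul _

theorem measurable_conditioner_apply {α : Type*} [MeasurableSpace α] {k : ℕ}
    {Q : α → Matrix (Fin n) (Fin k) ℝ} (hQ : ∀ a b, Measurable fun ω => Q ω a b)
    {B : α → Matrix (Fin k) (Fin k) ℝ} (hB : ∀ a b, Measurable fun ω => B ω a b) {s : α → ℝ}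
    (hs : Measurable s) (a b : Fin n) :
    Measurable fun ω => conditioner (Q ω) (B ω) (s ω) a b := by
  unfold conditioner
  have hQt : ∀ a b, Measurable fun ω => (Q ω)ᵀ a b := fun a b => hQ b a
  exact (measurable_mul_apply (measurable_mul_apply hQ hB) hQt a b).add
    (hs.mul (measurable_const.sub (measurable_mul_apply hQ hQt a b)))

theorem expectedGap_nonneg {x : Fin m → Fin n → ℝ} {ℓ : Fin m → EuclideanSpace ℝ (Fin p) → ℝ}
    {Wstar : Matrix (Fin p) (Fin n) ℝ} (hmin : ∀ W, empLoss x ℓ Wstar ≤ empLoss x ℓ W)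
    (g : Fin m → EuclideanSpace ℝ (Fin p) → EuclideanSpace ℝ (Fin p)) (η : ℝ) (T : ℕ)
    (A : Matrix (Fin n) (Fin n) ℝ) : 0 ≤ expectedGap x ℓ g η T A Wstar :=
  mul_nonneg (by positivity) (Finset.sum_nonneg fun _ _ => sub_nonneg.2 (hmin _))

end Measurability

/-! ### Combining the deterministic estimates -/

section Assembly

open scoped ENNReal

/-- The second inequality is Cauchy–Schwarz on the `n - k` discarded eigenvalues. -/
theorem sum_sqrt_eq_and_le {n k : ℕ} (hk : k ≤ n) {d : Fin n → ℝ} (hd : ∀ i, 0 ≤ d i) :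
    ∑ j : Fin k, √(d (Fin.castLE hk j)) ≤ ∑ i, √(d i) ∧
      ∑ i, √(d i) ≤ ∑ j : Fin k, √(d (Fin.castLE hk j))
        + √(((n : ℝ) - k) * (∑ i, d i - ∑ j : Fin k, d (Fin.castLE hk j))) := by
  obtain ⟨l, rfl⟩ := Nat.exists_eq_add_of_le hk
  have h : ∀ i : Fin k, Fin.castLE hk i = Fin.castAdd l i := fun i => rfl
  simp only [h]
  rw [Fin.sum_univ_add, Fin.sum_univ_add (f := d)]
  refine ⟨le_add_of_nonneg_right (Finset.sum_nonneg fun i _ => Real.sqrt_nonneg _), ?_⟩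
  rw [add_sub_cancel_left]
  push_cast
  rw [add_sub_cancel_left]
  refine add_le_add le_rfl (Real.le_sqrt_of_sq_le ?_)
  have := sq_sum_le_card_mul_sum_sq (s := Finset.univ) (f := fun i : Fin l => √(d (Fin.natAdd k i)))
  simpa only [Real.sq_sqrt (hd _), Finset.card_univ, Fintype.card_fin] using this

theorem psdSqrt_trace {n : ℕ} {M U : Matrix (Fin n) (Fin n) ℝ} {d : Fin n → ℝ}
    (h : IsSortedEigendecomposition M U d) : (psdSqrt M).trace = ∑ i, √(d i) := by
  rw [psdSqrt_eq h.orthogonal h.eq, trace_conj_diagonal h.orthogonal]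

variable {n m p k r T : ℕ}

/-- The bound for the optimization error when the sketch is fixed. -/
theorem expectedGap_le_of_isSketch (hm : 0 < m) (hk : 1 ≤ k) (hkn : k < n)
    {x : Fin m → Fin n → ℝ} {ℓ : Fin m → EuclideanSpace ℝ (Fin p) → ℝ}
    {g : Fin m → EuclideanSpace ℝ (Fin p) → EuclideanSpace ℝ (Fin p)}
    (hconv : ∀ i, ConvexOn ℝ Set.univ (ℓ i))
    (hg : ∀ i, IsSubgradientSelection (ℓ i) (g i)) {ρ : ℝ} (hρ0 : 0 < ρ)
    (hρ : ∀ i a, ‖g i a‖ ≤ ρ) (hT : 1 ≤ T) {Wstar : Matrix (Fin p) (Fin n) ℝ} {σ : ℝ}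
    (hσ : specNorm Wstar ≤ σ) {U : Matrix (Fin n) (Fin n) ℝ} {d : Fin n → ℝ}
    (hU : IsSortedEigendecomposition (corr x) U d) {V : Matrix (Fin m) (Fin k) ℝ}
    (hV : Vᵀ * V = 1) {S : Matrix (Fin n) (Fin m) ℝ}
    (hS : S = dataMatrix x - dataMatrix x * V * Vᵀ) {Ω : Matrix (Fin m) (Fin r) ℝ}
    {H : Matrix (Fin r) (Fin k) ℝ} (hH : Vᵀ * Ω * H = 1)
    (hrank : k ≤ (dataMatrix x * Ω * H).rank) {Q : Matrix (Fin n) (Fin k) ℝ}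
    (hQ : IsSketch (dataMatrix x) Ω Q) :
    (∃ ν : Fin k → ℝ, (∀ j, 0 < ν j) ∧ compressed (corr x) Q = Matrix.diagonal ν) ∧
    expectedGap x ℓ g (σ / (ρ * √T)) T (sketchedInv (corr x) Q) Wstar
      ≤ σ * ρ / √T * (∑ j : Fin k, √(d (Fin.castLE hkn.le j))
        + √(((n : ℝ) - k) / m) * (√(frobSq S) + √(frobSq (S * Ω * H)))) := by
  have hσ0 : 0 ≤ σ := (specNorm_nonneg _).trans hσ
  have hm' : (0 : ℝ) < m := by exact_mod_cast hm
  have hnk : (0 : ℝ) < (n : ℝ) - k := sub_pos.2 (by exact_mod_cast hkn)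
  obtain ⟨μ, hμ, hQQ, hQX, herr⟩ := hQ.spec hk hV hH hrank
  rw [← hS] at herr
  set ν : Fin k → ℝ := fun j => (m : ℝ)⁻¹ * μ j with hν
  have hν0 : ∀ j, 0 < ν j := fun j => mul_pos (inv_pos.2 hm') (hμ j)
  have hC : compressed (corr x) Q = Matrix.diagonal ν := by
    rw [compressed, corr_eq, Matrix.mul_smul, Matrix.smul_mul, hQX]
    ext i j
    by_cases hij : i = j
    · subst hij; simp [hν]
    · simp [hij]
  refine ⟨⟨ν, hν0, hC⟩, ?_⟩
  refine (expectedGap_le hm hkn hconv hg hρ0 hρ hT hσ hQQ hν0 hC).trans ?_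
  -- In the eigenbasis of `C` the sketch is the isometry `Uᵀ Q`, and `C̃` is the compression of a
  -- diagonal matrix.
  have h1 : ∑ j, √(ν j) ≤ ∑ j : Fin k, √(d (Fin.castLE hkn.le j)) := by
    refine sum_sqrt_compression_le hk hkn.le (N := Uᵀ * Q) ?_ hU.sorted (corr_diag_nonneg hU)
      hν0 ?_
    · have hU' : U * Uᵀ = 1 := mul_eq_one_comm.1 hU.orthogonal
      rw [Matrix.transpose_mul, Matrix.transpose_transpose, Matrix.mul_assoc, ← Matrix.mul_assoc U,
        hU', Matrix.one_mul, hQQ]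
    · rw [← hC, compressed, hU.eq, Matrix.transpose_mul, Matrix.transpose_transpose]
      simp only [Matrix.mul_assoc]
  have h2 : (corr x).trace - ∑ j, ν j
      ≤ (m : ℝ)⁻¹ * (frobSq S + frobSq (S * Ω * H)) := by
    rw [corr_trace, hν, ← Finset.mul_sum, ← mul_sub]
    exact mul_le_mul_of_nonneg_left herr (inv_nonneg.2 hm'.le)
  have h3 : √(((n : ℝ) - k) * ((corr x).trace - ∑ j, ν j))
      ≤ √(((n : ℝ) - k) / m) * (√(frobSq S) + √(frobSq (S * Ω * H))) := by
    have h4 : √(frobSq S + frobSq (S * Ω * H)) ≤ √(frobSq S) + √(frobSq (S * Ω * H)) := by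
      have := sqrt_sum_le_sum_sqrt (fun b : Bool => if b then frobSq S else frobSq (S * Ω * H))
        (fun b => by cases b <;> simp [frobSq_nonneg])
      simpa using this
    calc _ ≤ √(((n : ℝ) - k) / m * (frobSq S + frobSq (S * Ω * H))) := by
          refine Real.sqrt_le_sqrt ?_
          rw [div_eq_mul_inv, mul_assoc]
          exact mul_le_mul_of_nonneg_left h2 hnk.le
      _ = √(((n : ℝ) - k) / m) * √(frobSq S + frobSq (S * Ω * H)) :=
          Real.sqrt_mul (by positivity) _
      _ ≤ _ := by gcongr
  gcongr

end Assembly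

end SCSGD

/-! ### The main theorem -/

theorem mainTheorem6 (c : ℝ) (hc : 1 < c) :
    ∃ K : ℝ, 0 < K ∧
      ∀ (n m p k r T : ℕ) (_hk : 1 ≤ k) (hkn : k < n) (_hr : c * k ≤ r) (_hT : 1 ≤ T)
        (x : Fin m → Fin n → ℝ) (_hrank : k ≤ (SCSGD.corr x).rank)
        (ℓ : Fin m → EuclideanSpace ℝ (Fin p) → ℝ)
        (g : Fin m → EuclideanSpace ℝ (Fin p) → EuclideanSpace ℝ (Fin p))
        (ρ : ℝ≥0) (_hρ : 0 < ρ)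
        (_hconv : ∀ i, ConvexOn ℝ Set.univ (ℓ i))
        (_hlip : ∀ i, LipschitzWith ρ (ℓ i))
        (_hg : ∀ i, SCSGD.IsSubgradientSelection (ℓ i) (g i))
        (_hgm : ∀ i, Measurable (g i))
        (Wstar : Matrix (Fin p) (Fin n) ℝ)
        (_hmin : ∀ W, SCSGD.empLoss x ℓ Wstar ≤ SCSGD.empLoss x ℓ W)
        (σ : ℝ) (_hσ : SCSGD.specNorm Wstar ≤ σ)
        (U : Matrix (Fin n) (Fin n) ℝ) (d : Fin n → ℝ)
        (_hU : SCSGD.IsSortedEigendecomposition (SCSGD.corr x) U d)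
        (Q : (Fin m → Fin r → ℝ) → Matrix (Fin n) (Fin k) ℝ)
        (_hQm : ∀ a b, Measurable fun Ω => Q Ω a b)
        (_hQ : ∀ᵐ Ω ∂(SCSGD.sketchLaw m r),
          SCSGD.IsSketch (SCSGD.dataMatrix x) (Matrix.of Ω) (Q Ω)),
        let C := SCSGD.corr x
        let Ck := SCSGD.truncation hkn.le U d
        let η := σ / (ρ * Real.sqrt T)
        let gap := fun Ω => SCSGD.expectedGap x ℓ g η T (SCSGD.sketchedInv C (Q Ω)) Wstar
        let tail := Real.sqrt (((n : ℝ) - k) * (C.trace - Ck.trace))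
        let bound := σ * ρ / Real.sqrt T * ((SCSGD.psdSqrt Ck).trace + tail)
        let optBound := σ * ρ / Real.sqrt T * (SCSGD.psdSqrt C).trace
        Integrable gap (SCSGD.sketchLaw m r) ∧
        ∫ Ω, gap Ω ∂(SCSGD.sketchLaw m r) ≤ K * bound ∧
        ∀ κ : ℝ, 0 ≤ κ → tail ≤ κ * (SCSGD.psdSqrt C).trace →
          optBound ≤ bound ∧ bound ≤ (1 + κ) * optBound ∧
          ∫ Ω, gap Ω ∂(SCSGD.sketchLaw m r) ≤ K * (1 + κ) * optBound := by
  classical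
  have hc1 : 0 < c - 1 := by linarith
  set K₀ : ℝ := √(2 / (c - 1)) + √(Real.pi / 2) / (c - 1) with hK₀
  have hK₀0 : 0 ≤ K₀ := by positivity
  -- The `1` accounts for the best rank-`k` error and `K₀` for the expected excess due to sketching.
  refine ⟨1 + K₀, by positivity, ?_⟩
  intro n m p k r T hk hkn hr hT x hrank ℓ g ρ hρ hconv hlip hg hgm Wstar hmin σ hσ U d hU Q hQm hQ
    C Ck η gap tail bound optBound
  have hm : 0 < m := by
    rcases Nat.eq_zero_or_pos m with rfl | h
    · have : SCSGD.corr x = 0 := by simp [SCSGD.corr]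
      rw [this, Matrix.rank_zero] at hrank
      omega
    · exact h
  have hm' : (0 : ℝ) < m := by exact_mod_cast hm
  have hkR : (1 : ℝ) ≤ k := by exact_mod_cast hk
  have hkr : k ≤ r := by
    have : (k : ℝ) ≤ r := by nlinarith
    exact_mod_cast this
  have hr0 : r ≠ 0 := by omega
  have hv : ((r : ℝ≥0)⁻¹) ≠ 0 := by
    rw [Ne, inv_eq_zero]
    exact_mod_cast hr0
  have hσ0 : 0 ≤ σ := (SCSGD.specNorm_nonneg _).trans hσ
  have hnk : (0 : ℝ) < (n : ℝ) - k := sub_pos.2 (by exact_mod_cast hkn)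
  have hd0 := SCSGD.corr_diag_nonneg hU
  obtain ⟨V, hV, hSV, hVr⟩ := SCSGD.exists_rightSingular hkn.le hm hU hrank
  set S := SCSGD.dataMatrix x - SCSGD.dataMatrix x * V * Vᵀ with hS
  have hSV0 : S * V = 0 := by
    rw [hS, Matrix.sub_mul, Matrix.mul_assoc, hV, Matrix.mul_one, sub_self]
  have hgn : ∀ i a, ‖g i a‖ ≤ ρ := fun i a => (hg i).norm_le (hlip i) a
  have hind : ∀ᵐ Ω ∂(SCSGD.sketchLaw m r),
      LinearIndependent ℝ (Vᵀ * Matrix.of Ω : Matrix (Fin k) (Fin r) ℝ) :=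
    SCSGD.ae_transpose_mul hV (p := fun G => LinearIndependent ℝ G)
      isOpen_setOfPred_linearIndependent.measurableSet
      (SCSGD.ae_linearIndependent_gaussMat hv hkr)
  set E : (Fin m → Fin r → ℝ) → ℝ := fun Ω =>
    √(SCSGD.frobSq (S * Matrix.of Ω * SCSGD.rightInv (Vᵀ * Matrix.of Ω))) with hE
  set β₀ := σ * ρ / √(T : ℝ) with hβ₀
  have hβ₀0 : 0 ≤ β₀ := by positivity
  set s := ∑ j : Fin k, √(d (Fin.castLE hkn.le j)) with hs
  have hs0 : 0 ≤ s := Finset.sum_nonneg fun _ _ => Real.sqrt_nonneg _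
  have hkey : ∀ᵐ Ω ∂(SCSGD.sketchLaw m r),
      (∃ ν : Fin k → ℝ, (∀ j, 0 < ν j) ∧ SCSGD.compressed C (Q Ω) = Matrix.diagonal ν) ∧
      gap Ω ≤ β₀ * (s + √(((n : ℝ) - k) / m) * (√(SCSGD.frobSq S) + E Ω)) := by
    filter_upwards [hQ, hind] with Ω hΩ hi
    have hH := SCSGD.mul_rightInv hi
    exact SCSGD.expectedGap_le_of_isSketch hm hk hkn hconv hg (ρ := (ρ : ℝ)) hρ hgn hT hσ hU hV hS
      hH (hVr r _ _ hH) hΩ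
  have hgap0 : ∀ Ω, 0 ≤ gap Ω := fun Ω => SCSGD.expectedGap_nonneg hmin _ _ _ _
  -- Measurability of the matrix square root is bypassed: almost surely `C̃` is diagonal and
  -- positive, and the gap agrees with an expression in its diagonal entries.
  have hmeas : AEStronglyMeasurable gap (SCSGD.sketchLaw m r) := by
    have hCm : ∀ a b, Measurable fun Ω => SCSGD.compressed C (Q Ω) a b :=
      SCSGD.measurable_mul_apply (SCSGD.measurable_mul_apply (B := fun _ => C)
        (fun a b => hQm b a) fun _ _ => measurable_const) hQm
    have h1 : Measurable fun Ω => SCSGD.expectedGap x ℓ g η T (SCSGD.conditioner (Q Ω)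
        (Matrix.diagonal fun j => (√(SCSGD.compressed C (Q Ω) j j))⁻¹)
        (√(((n : ℝ) - k) / (C.trace - ∑ j, SCSGD.compressed C (Q Ω) j j)))) Wstar := by
      refine SCSGD.measurable_expectedGap T x (fun i => (hlip i).continuous.measurable) hgm η
        (SCSGD.measurable_conditioner_apply hQm (fun a b => ?_) ?_) Wstar
      · by_cases hab : a = b
        · subst hab
          simp only [Matrix.diagonal_apply_eq]
          exact (hCm a a).sqrt.inv
        · simp [Matrix.diagonal_apply_ne _ hab]
      · exact (measurable_const.div (measurable_const.sub
          (Finset.measurable_sum _ fun j _ => hCm j j))).sqrt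
    refine h1.aestronglyMeasurable.congr ?_
    filter_upwards [hkey] with Ω hΩ
    obtain ⟨⟨ν, hν, hC⟩, -⟩ := hΩ
    simp only [gap]
    rw [SCSGD.sketchedInv_eq hν hC, hC]
    simp only [Matrix.diagonal_apply_eq]
  have htail : tail = √(((n : ℝ) - k) / m) * √(SCSGD.frobSq S) := by
    rw [← Real.sqrt_mul (by positivity), hSV]
    simp only [tail]
    congr 1
    field_simp
    rfl
  have hCk : (SCSGD.psdSqrt Ck).trace = s := SCSGD.psdSqrt_truncation_trace hkn.le hU.orthogonal d
  have hbound : bound = β₀ * (s + tail) := by simp only [bound, hCk]; rfl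
  have htail0 : 0 ≤ tail := Real.sqrt_nonneg _
  -- Minimality of `W⋆` makes the gap nonnegative, so this single estimate yields both integrability
  -- and the bound on the integral.
  have hlint : ∫⁻ Ω, ENNReal.ofReal (gap Ω) ∂(SCSGD.sketchLaw m r)
      ≤ ENNReal.ofReal ((1 + K₀) * bound) := by
    have hEint := SCSGD.lintegral_frob_sketch_le hc hk hr hV hSV0
    rw [← hK₀] at hEint
    have hEm : Measurable E := SCSGD.measurable_frob_sketch S V
    set θ := √(((n : ℝ) - k) / m) with hθ
    have hθ0 : 0 ≤ θ := Real.sqrt_nonneg _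
    have hprob : IsProbabilityMeasure (SCSGD.sketchLaw m r) := by
      unfold SCSGD.sketchLaw; infer_instance
    calc _ ≤ ∫⁻ Ω, (ENNReal.ofReal (β₀ * (s + tail)) + ENNReal.ofReal (β₀ * θ)
            * ENNReal.ofReal (E Ω)) ∂(SCSGD.sketchLaw m r) := by
          refine lintegral_mono_ae ?_
          filter_upwards [hkey] with Ω hΩ
          rw [← ENNReal.ofReal_mul (by positivity), ← ENNReal.ofReal_add (by positivity)
            (mul_nonneg (by positivity) (Real.sqrt_nonneg _))]
          refine ENNReal.ofReal_le_ofReal (hΩ.2.trans (le_of_eq ?_))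
          rw [htail]; ring
      _ = ENNReal.ofReal (β₀ * (s + tail)) + ENNReal.ofReal (β₀ * θ)
            * ∫⁻ Ω, ENNReal.ofReal (E Ω) ∂(SCSGD.sketchLaw m r) := by
          rw [lintegral_add_left measurable_const, lintegral_const_mul _ hEm.ennreal_ofReal]
          simp
      _ ≤ ENNReal.ofReal (β₀ * (s + tail)) + ENNReal.ofReal (β₀ * θ)
            * ENNReal.ofReal (√(SCSGD.frobSq S) * K₀) := by gcongr; exact hEint
      _ = ENNReal.ofReal (β₀ * (s + tail) + β₀ * tail * K₀) := by
          rw [← ENNReal.ofReal_mul (by positivity), ← ENNReal.ofReal_add (by positivity)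
            (by positivity), htail]
          congr 2; ring
      _ ≤ _ := by
          refine ENNReal.ofReal_le_ofReal ?_
          rw [hbound]
          nlinarith [mul_nonneg (mul_nonneg hβ₀0 hs0) hK₀0]
  have hbound0 : 0 ≤ bound := by rw [hbound]; positivity
  have hint : ∫ Ω, gap Ω ∂(SCSGD.sketchLaw m r) ≤ (1 + K₀) * bound := by
    rw [integral_eq_lintegral_of_nonneg_ae (Filter.Eventually.of_forall hgap0) hmeas]
    exact ENNReal.toReal_le_of_le_ofReal (by positivity) hlint
  refine ⟨⟨hmeas, ?_⟩, hint, fun κ hκ hκt => ?_⟩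
  · rw [hasFiniteIntegral_iff_ofReal (Filter.Eventually.of_forall hgap0)]
    exact hlint.trans_lt ENNReal.ofReal_lt_top
  · have hCt : (SCSGD.psdSqrt C).trace = ∑ i, √(d i) := SCSGD.psdSqrt_trace hU
    have hopt : optBound = β₀ * ∑ i, √(d i) := by simp only [optBound, hCt]; rfl
    have hcomp := SCSGD.sum_sqrt_eq_and_le hkn.le hd0
    have htail2 : tail
        = √(((n : ℝ) - k) * (∑ i, d i - ∑ j : Fin k, d (Fin.castLE hkn.le j))) := by
      have h1 : C.trace = ∑ i, d i := by
        rw [← SCSGD.trace_conj_diagonal hU.orthogonal d, ← hU.eq]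
      have h2 : Ck.trace = ∑ j : Fin k, d (Fin.castLE hkn.le j) :=
        SCSGD.truncation_trace hkn.le hU.orthogonal d
      simp only [tail, h1, h2]
    rw [hCt] at hκt
    rw [← htail2] at hcomp
    have hb : bound ≤ (1 + κ) * optBound := by
      rw [hbound, hopt]
      calc β₀ * (s + tail) ≤ β₀ * (∑ i, √(d i) + κ * ∑ i, √(d i)) := by
            gcongr; exact hcomp.1
        _ = _ := by ring
    refine ⟨?_, hb, hint.trans ?_⟩
    · rw [hbound, hopt]
      exact mul_le_mul_of_nonneg_left hcomp.2 hβ₀0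
    · rw [mul_assoc]
      exact mul_le_mul_of_nonneg_left hb (by positivity)
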